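/- Graphs are simple and undirected, of arbitrary (possibly infinite) size and degrees. A connected graph has \emph{connectivity $1$} if it has a vertex $x$ (a \emph{cutvertex}) such that $X\setminus x$ is disconnected, i.e. some two remaining vertices are not joined by a path in $X\setminus x$. The \emph{blocks} of $X$ are its maximal connected subgraphs that do not have connectivity $1$; the automorphism group of a block is its automorphism group as a graph in its own right. A graph is \emph{transitive} if its automorphism group acts transitively on its vertices. Let $X$ be a transitive graph with connectivity $1$, let $G=\operatorname{Aut}X$, and let $n$ be the number (possibly infinite) of blocks that a vertex of $X$ lies in; by transitivity $n$ does not depend on the vertex. (i) If the automorphism group of some block is not transitive on the vertices of that block, then $G$ is not simple. (ii) Suppose that for every block $B$ the group $\operatorname{Aut}B$ is transitive on the vertices of $B$ and is generated by the stabilizers $(\operatorname{Aut}B)_x$ of the vertices $x$ of $B$. Then $G$ is simple, unless $n=2$ and any two blocks are isomorphic; in that case $G$ has a normal subgroup of index $2$ that is simple. -/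

import Mathlib

namespace SimpleGraph

universe u

variable {V : Type u}

/-- The vertex `x` is a cutvertex: deleting it leaves a graph with two vertices that are not joined
by a path. (`Preconnected`, so that the empty graph left of a one-vertex graph is not counted as
disconnected.) -/
def IsCutvertex (X : SimpleGraph V) (x : V) : Prop :=
  ¬ (X.induce {x}ᶜ).Preconnected

/-- A connected graph has connectivity 1 if it has a cutvertex. -/
def HasConnectivityOne (X : SimpleGraph V) : Prop :=
  X.Connected ∧ ∃ x, X.IsCutvertex x

/-- The blocks of a graph are the maximal connected subgraphs that do not have connectivity 1. -/
def IsBlock (X : SimpleGraph V) (B : X.Subgraph) : Prop :=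
  Maximal (fun H : X.Subgraph => H.coe.Connected ∧ ¬ H.coe.HasConnectivityOne) B

/-- The number of blocks that contain the vertex `x` (`⊤` if there are infinitely many). -/
noncomputable def numBlocksAt (X : SimpleGraph V) (x : V) : ℕ∞ :=
  {B : X.Subgraph | X.IsBlock B ∧ x ∈ B.verts}.encard

/-- The automorphism group of the graph acts transitively on the vertex set. -/
def IsTransitive (X : SimpleGraph V) : Prop :=
  MulAction.IsPretransitive (X ≃g X) V

/-- The automorphism group of the graph is generated by the stabilizers of the vertices. -/
def AutGeneratedByStabilizers (X : SimpleGraph V) : Prop :=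
  (⨆ x : V, MulAction.stabilizer (X ≃g X) x) = ⊤

/-- Every vertex lies in exactly two blocks and any two blocks are isomorphic. -/
def HasTwoIsomorphicBlocks (X : SimpleGraph V) : Prop :=
  (∀ x : V, X.numBlocksAt x = 2) ∧
    ∀ B C : X.Subgraph, X.IsBlock B → X.IsBlock C → Nonempty (B.coe ≃g C.coe)

end SimpleGraph

open scoped Pointwise

namespace SimpleGraph

universe u

variable {V : Type u} {X Y : SimpleGraph V} {B C D R R' S T C' D' : Set V}
  {u' v' z' r u v w x y z : V}

/-! The blocks of a connected graph are arranged like a tree. Two of them share at most one vertex,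
and every vertex `v` has a projection `proj X B v` to each block `B`: the vertex of `B` at which the
branch containing `v` is attached.

Part (i): if `Aut B` is not transitive on `B`, choose `x` and `y` in `B` that no automorphism
preserving `B` maps one to the other. Going from `a` to `b`, count +1 for each block entered, and -1
for each block left, at a vertex such that the flag (vertex, block) lies in the orbit of `(x, B)`.
The count is finite, additive and invariant, so `g ↦ count(x, g x)` is a homomorphism to the
integers; it takes the value 1 when `g x = y` (`not_isSimpleGroup_of_block`).

Part (ii): since blocks are transitive, an isomorphism between blocks extends to an automorphism of
`X`, constructed branch by branch (`exists_aut_extending`). With the generation hypothesis, the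
normal subgroup `flagSubgroup` generated by the flag stabilizers is therefore transitive on
vertices. Its simplicity follows by an argument in the style of Tits. A nontrivial subgroup `N`
normalized by it contains some `f` translating along a line through a block; an automorphism
supported on a branch off that line is a commutator of `f` with an infinite product of its own
conjugates, hence in `N` (`mem_of_fixes`). Each flag stabilizer element is a product of two
automorphisms supported on branches, so `flagSubgroup ≤ N`.

It remains to compare `flagSubgroup` with the whole group. If an automorphism fixes `x` and moves a
block at `x`, a third block at `x` allows it to be corrected by a swap that fixes this third block.
The only obstruction is that there are just two blocks at each vertex and all are isomorphic; then
the blocks have a proper two-colouring, and `flagSubgroup` is the subgroup of index 2 preserving it.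
-/

/-- The set `S` induces a preconnected subgraph, phrased through predicates that propagate along
the edges inside `S`. -/
def ConnOn (X : SimpleGraph V) (S : Set V) : Prop :=
  ∀ P : V → Prop, (∀ u ∈ S, ∀ v ∈ S, X.Adj u v → P u → P v) → ∀ u ∈ S, ∀ v ∈ S, P u → P v

/-- The set `S` is nonempty and stays connected after the deletion of at most one vertex. -/
structure NonSep (X : SimpleGraph V) (S : Set V) : Prop where
  nonempty : S.Nonempty
  connOn : ∀ D : Set V, D.Subsingleton → X.ConnOn (S \ D)

/-- The vertex sets of blocks. -/
def IsBlockSet (X : SimpleGraph V) (S : Set V) : Prop :=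
  Maximal X.NonSep S

/-! ### Blocks as sets of vertices -/

theorem preconnected_iff_forall_pred {W : Type*} (Y : SimpleGraph W) :
    Y.Preconnected ↔ ∀ P : W → Prop, (∀ u v, Y.Adj u v → P u → P v) → ∀ u v, P u → P v := by
  constructor
  · rintro h P hP u v hu
    obtain ⟨p⟩ := h u v
    induction p with
    | nil => exact hu
    | cons hadj _ ih => exact ih (hP _ _ hadj hu)
  · intro h u v
    exact h (fun w => Y.Reachable u w) (fun a b hab ha => ha.trans hab.reachable) u v
      (Reachable.refl u)

theorem preconnected_iff_connOn (f : V → Prop) (Z : SimpleGraph {v // f v})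
    (hZ : ∀ u v, Z.Adj u v ↔ Y.Adj u v) : Z.Preconnected ↔ Y.ConnOn {v | f v} := by
  rw [preconnected_iff_forall_pred]
  constructor
  · intro h P hP u hu v hv
    exact h (fun w => P w) (fun a b hab => hP a a.2 b b.2 ((hZ _ _).1 hab)) ⟨u, hu⟩ ⟨v, hv⟩
  · intro h P hP u v hu
    obtain ⟨_, h2⟩ := h (fun w => ∃ hw : f w, P ⟨w, hw⟩)
      (fun a ha b hb hab ⟨_, hPa⟩ => ⟨hb, hP ⟨a, ha⟩ ⟨b, hb⟩ ((hZ _ _).2 hab) hPa⟩)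
      u u.2 v v.2 ⟨u.2, hu⟩
    exact h2

theorem preconnected_induce_compl_iff_connOn (H : X.Subgraph) (x : H.verts) :
    (H.coe.induce {x}ᶜ).Preconnected ↔ H.spanningCoe.ConnOn (H.verts \ {(x : V)}) := by
  rw [preconnected_iff_forall_pred]
  constructor
  · intro h P hP u hu v hv
    exact h (fun w => P w)
      (fun a b hab => hP a ⟨a.1.2, fun h => a.2 (Subtype.ext h)⟩ b
        ⟨b.1.2, fun h => b.2 (Subtype.ext h)⟩ hab)
      ⟨⟨u, hu.1⟩, fun h => hu.2 (congrArg Subtype.val h)⟩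
      ⟨⟨v, hv.1⟩, fun h => hv.2 (congrArg Subtype.val h)⟩
  · intro h P hP u v hu
    obtain ⟨_, _, h2⟩ := h (fun w => ∃ (hw : w ∈ H.verts)
        (hx : (⟨w, hw⟩ : H.verts) ∈ ({x}ᶜ : Set _)), P ⟨⟨w, hw⟩, hx⟩)
      (fun a ha b hb hab ⟨ha1, ha2, hPa⟩ => ⟨hb.1, fun h => hb.2 (congrArg Subtype.val h),
        hP ⟨⟨a, ha1⟩, ha2⟩ _ hab hPa⟩)
      u ⟨u.1.2, fun h => u.2 (Subtype.ext h)⟩ v ⟨v.1.2, fun h => v.2 (Subtype.ext h)⟩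
      ⟨u.1.2, u.2, hu⟩
    exact h2

/-- Deleting the empty set expresses connectedness, deleting a vertex of `H` expresses that it is no
cutvertex, and deleting any other vertex changes nothing. -/
theorem connected_not_hasConnectivityOne_iff (H : X.Subgraph) :
    (H.coe.Connected ∧ ¬ H.coe.HasConnectivityOne) ↔ H.spanningCoe.NonSep H.verts := by
  have hpre : H.coe.Preconnected ↔ H.spanningCoe.ConnOn H.verts :=
    preconnected_iff_connOn (fun v => v ∈ H.verts) H.coe (fun _ _ => Iff.rfl)
  constructor
  · rintro ⟨hc, hn⟩
    have hne : H.verts.Nonempty := Set.nonempty_coe_sort.1 hc.nonempty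
    refine ⟨hne, fun D hD => ?_⟩
    have h0 := hpre.1 hc.preconnected
    rcases hD.eq_empty_or_singleton with rfl | ⟨x, rfl⟩
    · simpa using h0
    · by_cases hx : x ∈ H.verts
      · by_contra hcon
        refine hn ⟨hc, ⟨x, hx⟩, fun h => hcon ?_⟩
        exact (preconnected_induce_compl_iff_connOn H ⟨x, hx⟩).1 h
      · rwa [Set.sdiff_singleton_eq_self hx]
  · rintro ⟨hne, h⟩
    have h0 : H.coe.Preconnected := hpre.2 (by simpa using h ∅ Set.subsingleton_empty)
    have : Nonempty H.verts := hne.to_subtype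
    refine ⟨⟨h0⟩, ?_⟩
    rintro ⟨-, x, hx⟩
    exact hx ((preconnected_induce_compl_iff_connOn H x).2 (h _ Set.subsingleton_singleton))

theorem ConnOn.congr (h : X.ConnOn S) (hXY : ∀ u ∈ S, ∀ v ∈ S, X.Adj u v → Y.Adj u v) :
    Y.ConnOn S :=
  fun P hP => h P fun u hu v hv huv => hP u hu v hv (hXY u hu v hv huv)

theorem NonSep.congr (h : X.NonSep S) (hXY : ∀ u ∈ S, ∀ v ∈ S, X.Adj u v → Y.Adj u v) :
    Y.NonSep S :=
  ⟨h.1, fun D hD => (h.2 D hD).congr fun u hu v hv => hXY u hu.1 v hv.1⟩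

theorem NonSep.induce (h : X.NonSep S) :
    ((⊤ : X.Subgraph).induce S).spanningCoe.NonSep S :=
  h.congr fun u hu v hv huv => by simp [hu, hv, huv]

/-- Adding edges on the same vertices preserves `NonSep`, so a maximal subgraph is induced and is
determined by its vertex set. -/
theorem isBlock_iff (B : X.Subgraph) :
    X.IsBlock B ↔ X.IsBlockSet B.verts ∧ B = (⊤ : X.Subgraph).induce B.verts := by
  have hle : ∀ H : X.Subgraph, H ≤ (⊤ : X.Subgraph).induce H.verts := fun H =>
    ⟨subset_rfl, fun u v h => ⟨h.fst_mem, h.snd_mem, H.adj_sub h⟩⟩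
  unfold IsBlock IsBlockSet
  simp only [connected_not_hasConnectivityOne_iff]
  constructor
  · rintro ⟨h1, h2⟩
    have hX : X.NonSep B.verts := h1.congr fun u _ v _ huv => B.adj_sub huv
    refine ⟨⟨hX, fun T hT hBT => ?_⟩, ?_⟩
    · have := h2 (y := (⊤ : X.Subgraph).induce T) hT.induce ((hle B).trans ?_)
      · exact this.1
      · exact Subgraph.induce_mono_right hBT
    · exact le_antisymm (hle B) (h2 (y := (⊤ : X.Subgraph).induce B.verts) hX.induce (hle B))
  · rintro ⟨⟨h1, h2⟩, hB⟩
    refine ⟨?_, fun H hH hBH => ?_⟩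
    · have := h1.induce
      rwa [← hB] at this
    · rw [hB]
      refine (hle H).trans (Subgraph.induce_mono_right ?_)
      exact h2 (hH.congr fun u _ v _ huv => H.adj_sub huv) hBH.1

theorem IsBlock.isBlockSet {B : X.Subgraph} (h : X.IsBlock B) : X.IsBlockSet B.verts :=
  ((isBlock_iff B).1 h).1

theorem IsBlock.coe_eq {B : X.Subgraph} (h : X.IsBlock B) : B.coe = X.induce B.verts := by
  ext u v
  have h2 := ((isBlock_iff B).1 h).2
  have : B.Adj u v ↔ ((⊤ : X.Subgraph).induce B.verts).Adj u v := by rw [← h2]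
  simpa using this

theorem IsBlockSet.isBlock (h : X.IsBlockSet S) : X.IsBlock ((⊤ : X.Subgraph).induce S) :=
  (isBlock_iff _).2 ⟨h, rfl⟩

theorem numBlocksAt_eq (x : V) :
    X.numBlocksAt x = {S : Set V | X.IsBlockSet S ∧ x ∈ S}.encard := by
  unfold numBlocksAt
  have hinj : Set.InjOn (fun B : X.Subgraph => B.verts) {B | X.IsBlock B ∧ x ∈ B.verts} := by
    intro B hB C hC hBC
    have h1 := ((isBlock_iff B).1 hB.1).2
    have h2 := ((isBlock_iff C).1 hC.1).2
    have h3 : B.verts = C.verts := hBC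
    rw [h1, h2, h3]
  rw [← hinj.encard_image]
  congr 1
  ext S
  constructor
  · rintro ⟨B, hB, rfl⟩
    exact ⟨hB.1.isBlockSet, hB.2⟩
  · rintro ⟨hS, hx⟩
    exact ⟨_, ⟨hS.isBlock, hx⟩, rfl⟩

/-! ### Elementary properties of blocks -/

theorem ConnOn.union (hS : X.ConnOn S) (hT : X.ConnOn T) (h : (S ∩ T).Nonempty) :
    X.ConnOn (S ∪ T) := by
  obtain ⟨c, hcS, hcT⟩ := h
  intro P hP u hu v hv hPu
  have hS' := hS P fun a ha b hb => hP a (Or.inl ha) b (Or.inl hb)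
  have hT' := hT P fun a ha b hb => hP a (Or.inr ha) b (Or.inr hb)
  have hc : P c := hu.elim (fun h => hS' u h c hcS hPu) (fun h => hT' u h c hcT hPu)
  exact hv.elim (fun h => hS' c hcS v h hc) (fun h => hT' c hcT v h hc)

/-- Of two common vertices, one survives the deletion and keeps the two sets joined. -/
theorem NonSep.union (hS : X.NonSep S) (hT : X.NonSep T) (h : (S ∩ T).Nontrivial) :
    X.NonSep (S ∪ T) := by
  refine ⟨hS.1.mono Set.subset_union_left, fun D hD => ?_⟩
  rw [Set.union_sdiff_distrib]
  refine (hS.2 D hD).union (hT.2 D hD) ?_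
  obtain ⟨a, ha, b, hb, hab⟩ := h
  by_cases haD : a ∈ D
  · exact ⟨b, ⟨hb.1, fun h => hab (hD haD h)⟩, ⟨hb.2, fun h => hab (hD haD h)⟩⟩
  · exact ⟨a, ⟨ha.1, haD⟩, ⟨ha.2, haD⟩⟩

theorem IsBlockSet.eq_of_nontrivial (hB : X.IsBlockSet B) (hC : X.IsBlockSet C)
    (h : (B ∩ C).Nontrivial) : B = C := by
  have hU := hB.1.union hC.1 h
  exact (Set.subset_union_left.antisymm (hB.2 hU Set.subset_union_left)).trans
    (Set.subset_union_right.antisymm (hC.2 hU Set.subset_union_right)).symm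

theorem IsBlockSet.eq_of_mem (hB : X.IsBlockSet B) (hC : X.IsBlockSet C) (h : B ≠ C)
    (hu : u ∈ B) (hu' : u ∈ C) (hv : v ∈ B) (hv' : v ∈ C) : u = v := by
  by_contra hne
  exact h (hB.eq_of_nontrivial hC ⟨u, ⟨hu, hu'⟩, v, ⟨hv, hv'⟩, hne⟩)

theorem nonSep_pair (h : X.Adj u v) : X.NonSep {u, v} := by
  refine ⟨⟨u, by simp⟩, fun D hD P hP a ha b hb hPa => ?_⟩
  rcases eq_or_ne a b with rfl | hab
  · exact hPa
  · refine hP a ha b hb ?_ hPa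
    obtain ⟨rfl | rfl, -⟩ := ha <;> obtain ⟨rfl | rfl, -⟩ := hb
    · exact absurd rfl hab
    · exact h
    · exact h.symm
    · exact absurd rfl hab

theorem NonSep.exists_isBlockSet (hS : X.NonSep S) : ∃ B, X.IsBlockSet B ∧ S ⊆ B := by
  obtain ⟨B, hSB, hB⟩ := zorn_subset_nonempty {T | X.NonSep T} (fun c hc hchain hne => by
    refine ⟨⋃₀ c, ⟨?_, fun D hD P hP u hu v hv => ?_⟩, fun s hs => Set.subset_sUnion_of_mem hs⟩
    · obtain ⟨T, hT⟩ := hne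
      exact (hc hT).1.mono (Set.subset_sUnion_of_mem hT)
    · obtain ⟨⟨T, hT, huT⟩, huD⟩ := hu
      obtain ⟨⟨T', hT', hvT'⟩, hvD⟩ := hv
      have key : ∀ R ∈ c, u ∈ R → v ∈ R → P u → P v := fun R hR hu hv =>
        (hc hR).2 D hD P (fun a ha b hb => hP a ⟨⟨R, hR, ha.1⟩, ha.2⟩ b ⟨⟨R, hR, hb.1⟩, hb.2⟩)
          u ⟨hu, huD⟩ v ⟨hv, hvD⟩
      rcases hchain.total hT hT' with h | h
      · exact key T' hT' (h huT) hvT'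
      · exact key T hT huT (h hvT')) S hS
  exact ⟨B, hB, hSB⟩

theorem exists_isBlockSet_of_adj (h : X.Adj u v) : ∃ B, X.IsBlockSet B ∧ u ∈ B ∧ v ∈ B := by
  obtain ⟨B, hB, hs⟩ := (nonSep_pair h).exists_isBlockSet
  exact ⟨B, hB, hs (by simp), hs (by simp)⟩

theorem Connected.pred (hc : X.Connected) {P : V → Prop} (hP : ∀ u v, X.Adj u v → P u → P v)
    (hu : P u) (v : V) : P v :=
  (preconnected_iff_forall_pred X).1 hc.preconnected P hP u v hu

/-! ### The projection onto a block -/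

/-- The graph without the edges that have both ends in `B`. -/
def offGraph (X : SimpleGraph V) (B : Set V) : SimpleGraph V where
  Adj u v := X.Adj u v ∧ ¬ (u ∈ B ∧ v ∈ B)
  symm := ⟨fun _ _ h => ⟨h.1.symm, fun h' => h.2 h'.symm⟩⟩
  loopless := ⟨fun _ h => h.1.ne rfl⟩

theorem walk_iff {Y : SimpleGraph V} (hYX : Y ≤ X) {P : V → Prop}
    (hP : ∀ u ∈ S, ∀ v ∈ S, X.Adj u v → P u → P v) (p : Y.Walk u v)
    (hp : ∀ a ∈ p.support, a ∈ S) : P u ↔ P v := by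
  induction p with
  | nil => rfl
  | @cons a b c hadj q ih =>
    have ha : a ∈ S := hp a (by simp)
    have hb : b ∈ S := hp b (by simp)
    refine Iff.trans ⟨hP a ha b hb (hYX hadj), hP b hb a ha (hYX hadj).symm⟩
      (ih fun d hd => hp d ?_)
    simp [hd]

theorem offGraph_le : X.offGraph B ≤ X := fun _ _ h => h.1

theorem Walk.IsPath.not_mem_takeUntil_or_dropUntil [DecidableEq V] {Y : SimpleGraph V} {a : V}
    {p : Y.Walk u v} (hp : p.IsPath) (ha : a ∈ p.support) (hxa : x ≠ a) :
    x ∉ (p.takeUntil a ha).support ∨ x ∉ (p.dropUntil a ha).support := by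
  by_contra! h
  have hnd := hp.support_nodup
  rw [← p.take_spec ha, Walk.support_append, List.nodup_append] at hnd
  have h2 := h.2
  rw [Walk.mem_support_iff] at h2
  exact hnd.2.2 x h.1 x (h2.resolve_left hxa) rfl

/-- A path between vertices of `B` can be added to `B` as an ear: a deleted vertex meets at most one
of the two parts into which a surviving vertex cuts the path, so the other part still leads to `B`.
By maximality the path stays in `B`, where `offGraph` has no edges. This makes the projection
unique. -/
theorem IsBlockSet.eq_of_reachable (hB : X.IsBlockSet B) (hu : u ∈ B) (hv : v ∈ B)
    (h : (X.offGraph B).Reachable u v) : u = v := by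
  classical
  obtain ⟨p, hp⟩ := h.exists_isPath
  set S : Set V := B ∪ {a | a ∈ p.support} with hS
  have hNS : X.NonSep S := by
    refine ⟨⟨u, Or.inl hu⟩, fun D hD P hP => ?_⟩
    have hBD := hB.1.2 D hD P fun a ha b hb => hP a ⟨Or.inl ha.1, ha.2⟩ b ⟨Or.inl hb.1, hb.2⟩
    have key : ∀ a ∈ S \ D, ∃ b ∈ B \ D, P a ↔ P b := by
      rintro a ⟨ha | ha, haD⟩
      · exact ⟨a, ⟨ha, haD⟩, Iff.rfl⟩
      have ha : a ∈ p.support := ha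
      have h1 : (∀ x ∈ (p.takeUntil a ha).support, x ∉ D) ∨
          (∀ x ∈ (p.dropUntil a ha).support, x ∉ D) := by
        by_contra! hcon
        obtain ⟨⟨y, hy, hyD⟩, ⟨y', hy', hyD'⟩⟩ := hcon
        obtain rfl := hD hyD hyD'
        exact (hp.not_mem_takeUntil_or_dropUntil ha
          (fun h => haD (h ▸ hyD))).elim (fun h => h hy) (fun h => h hy')
      rcases h1 with h1 | h1
      · refine ⟨u, ⟨hu, h1 u (by simp)⟩, (walk_iff offGraph_le hP (p.takeUntil a ha) ?_).symm⟩
        exact fun b hb => ⟨Or.inr (p.support_takeUntil_subset_support ha hb), h1 b hb⟩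
      · refine ⟨v, ⟨hv, h1 v (by simp)⟩, walk_iff offGraph_le hP (p.dropUntil a ha) ?_⟩
        exact fun b hb => ⟨Or.inr (p.support_dropUntil_subset_support ha hb), h1 b hb⟩
    intro a ha b hb hPa
    obtain ⟨a', ha', h1⟩ := key a ha
    obtain ⟨b', hb', h2⟩ := key b hb
    exact h2.2 (hBD a' ha' b' hb' (h1.1 hPa))
  have hSB : S ⊆ B := hB.2 hNS Set.subset_union_left
  cases p with
  | nil => rfl
  | cons hadj q => exact absurd ⟨hu, hSB (Or.inr (by simp))⟩ hadj.2

open Classical in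
/-- The vertex of `B` at which the branch containing `v` is attached to `B`. -/
noncomputable def proj (X : SimpleGraph V) (B : Set V) (v : V) : V :=
  if h : ∃ z ∈ B, (X.offGraph B).Reachable v z then h.choose else v

theorem Connected.proj_spec (hc : X.Connected) (hB : B.Nonempty) (v : V) :
    X.proj B v ∈ B ∧ (X.offGraph B).Reachable v (X.proj B v) := by
  have h : ∃ z ∈ B, (X.offGraph B).Reachable v z := by
    obtain ⟨b, hb⟩ := hB
    refine hc.pred (P := fun v => ∃ z ∈ B, (X.offGraph B).Reachable v z) ?_
      ⟨b, hb, Reachable.refl b⟩ v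
    rintro a c hac ⟨z, hz, haz⟩
    by_cases h : c ∈ B
    · exact ⟨c, h, Reachable.refl c⟩
    · refine ⟨z, hz, Reachable.trans ?_ haz⟩
      exact Adj.reachable ⟨hac.symm, fun h' => h h'.1⟩
  unfold proj
  rw [dif_pos h]
  exact h.choose_spec

theorem IsBlockSet.proj_mem (hc : X.Connected) (hB : X.IsBlockSet B) (v : V) : X.proj B v ∈ B :=
  (hc.proj_spec hB.1.1 v).1

theorem IsBlockSet.proj_eq (hc : X.Connected) (hB : X.IsBlockSet B) (hz : z ∈ B)
    (h : (X.offGraph B).Reachable v z) : X.proj B v = z :=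
  hB.eq_of_reachable (hB.proj_mem hc v) hz ((hc.proj_spec hB.1.1 v).2.symm.trans h)

theorem IsBlockSet.proj_of_mem (hc : X.Connected) (hB : X.IsBlockSet B) (hv : v ∈ B) :
    X.proj B v = v :=
  hB.proj_eq hc hv (Reachable.refl v)

theorem IsBlockSet.proj_eq_of_adj (hc : X.Connected) (hB : X.IsBlockSet B) (h : X.Adj u v)
    (hn : ¬ (u ∈ B ∧ v ∈ B)) : X.proj B u = X.proj B v :=
  hB.proj_eq hc (hB.proj_mem hc v)
    (Reachable.trans (Adj.reachable ⟨h, hn⟩) (hc.proj_spec hB.1.1 v).2)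

/-- The blocks share at most one vertex, so no edge inside `C` has both ends in `B`, and the
projection does not change along such an edge. -/
theorem IsBlockSet.proj_const (hc : X.Connected) (hB : X.IsBlockSet B) (hC : X.IsBlockSet C)
    (hBC : B ≠ C) (hu : u ∈ C) (hv : v ∈ C) : X.proj B u = X.proj B v := by
  have := hC.1.2 ∅ Set.subsingleton_empty
  rw [Set.sdiff_empty] at this
  refine this (fun w => X.proj B u = X.proj B w) (fun a ha b hb hab h => h.trans ?_) u hu v hv rfl
  exact hB.proj_eq_of_adj hc hab fun h => hab.ne (hB.eq_of_mem hC hBC h.1 ha h.2 hb)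

/-- If `v` and the block `C` lie in different branches at the block `B`, then seen from `C` the
vertex `v` lies in the same branch as `B`. -/
theorem IsBlockSet.proj_eq_proj (hc : X.Connected) (hB : X.IsBlockSet B) (hC : X.IsBlockSet C)
    (hBC : B ≠ C) (hu : u ∈ B) (hz : z ∈ C) (hv : X.proj B v ≠ X.proj B z) :
    X.proj C v = X.proj C u := by
  rw [← hC.proj_const hc hB hBC.symm (hB.proj_mem hc v) hu]
  obtain ⟨p⟩ := (hc.proj_spec hB.1.1 v).2
  have hq : X.proj B (X.proj B v) ≠ X.proj B z := by rwa [hB.proj_of_mem hc (hB.proj_mem hc v)]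
  generalize X.proj B v = w at p hq
  induction p with
  | nil => rfl
  | @cons a b c hadj q ih =>
    have hbc : X.proj B b ≠ X.proj B z := by
      have : X.proj B b = X.proj B c :=
        hB.proj_eq hc (hB.proj_mem hc c) (Reachable.trans ⟨q⟩ (hc.proj_spec hB.1.1 c).2)
      rwa [this]
    rw [← ih hbc hq]
    refine hC.proj_eq_of_adj hc hadj.1 fun h => hbc ?_
    exact hB.proj_const hc hC hBC h.2 hz

/-! ### The action of the automorphism group on blocks -/

theorem adj_smul_iff (g : X ≃g X) : X.Adj (g • u) (g • v) ↔ X.Adj u v :=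
  g.map_rel_iff

theorem ConnOn.smul (h : X.ConnOn S) (g : X ≃g X) : X.ConnOn (g • S) := by
  rintro P hP _ ⟨u, hu, rfl⟩ _ ⟨v, hv, rfl⟩
  refine h (fun w => P (g • w)) (fun a ha b hb hab => ?_) u hu v hv
  exact hP _ (Set.smul_mem_smul_set ha) _ (Set.smul_mem_smul_set hb) ((adj_smul_iff g).2 hab)

theorem NonSep.smul (h : X.NonSep S) (g : X ≃g X) : X.NonSep (g • S) := by
  refine ⟨h.1.smul_set, fun D hD => ?_⟩
  have := (h.2 (g⁻¹ • D) (hD.image _)).smul g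
  rwa [Set.smul_set_sdiff, smul_inv_smul] at this

theorem IsBlockSet.smul (h : X.IsBlockSet B) (g : X ≃g X) : X.IsBlockSet (g • B) := by
  refine ⟨h.1.smul g, fun T hT hBT => ?_⟩
  rw [← Set.smul_set_subset_smul_set_iff (a := g⁻¹), inv_smul_smul]
  refine h.2 (hT.smul g⁻¹) ?_
  rwa [Set.subset_smul_set_iff, inv_inv]

theorem isBlockSet_smul_iff (g : X ≃g X) : X.IsBlockSet (g • B) ↔ X.IsBlockSet B :=
  ⟨fun h => by simpa using h.smul g⁻¹, fun h => h.smul g⟩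

theorem reachable_offGraph_smul (g : X ≃g X) (h : (X.offGraph B).Reachable u v) :
    (X.offGraph (g • B)).Reachable (g • u) (g • v) := by
  obtain ⟨p⟩ := h
  induction p with
  | nil => exact Reachable.refl _
  | cons hadj _ ih =>
    refine Reachable.trans (Adj.reachable ⟨(adj_smul_iff g).2 hadj.1, ?_⟩) ih
    simpa only [Set.smul_mem_smul_set_iff] using hadj.2

theorem IsBlockSet.proj_smul (hc : X.Connected) (hB : X.IsBlockSet B) (g : X ≃g X) (v : V) :
    X.proj (g • B) (g • v) = g • X.proj B v :=
  (hB.smul g).proj_eq hc (Set.smul_mem_smul_set (hB.proj_mem hc v))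
    (reachable_offGraph_smul g (hc.proj_spec hB.1.1 v).2)

/-! ### Blocks separating two vertices -/

theorem Connected.finite_setOf_proj_ne (hc : X.Connected) (x y : V) :
    {C | X.IsBlockSet C ∧ X.proj C x ≠ X.proj C y}.Finite := by
  refine hc.pred (P := fun y => {C | X.IsBlockSet C ∧ X.proj C x ≠ X.proj C y}.Finite) ?_
    (u := x) (by simp) y
  intro u v huv hfin
  obtain ⟨E, hE, huE, hvE⟩ := exists_isBlockSet_of_adj huv
  -- Moving along one edge changes the projection only to the block `E` that contains the edge.
  refine (hfin.union (Set.finite_singleton E)).subset ?_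
  rintro C ⟨hC, hne⟩
  by_cases h : C = E
  · exact Or.inr h
  · refine Or.inl ⟨hC, ?_⟩
    rwa [hC.proj_const hc hE h huE hvE]

/-! ### Part (i): the counting character -/

/-- A nontrivial additive character excludes simplicity. -/
theorem not_isSimpleGroup_of_map_mul_eq_add {G : Type*} [Group G] (φ : G → ℤ)
    (hφ : ∀ a b, φ (a * b) = φ a + φ b) {g : G} (hg : φ g = 1) : ¬ IsSimpleGroup G := by
  intro hG
  have h1 : φ 1 = 0 := by simpa using hφ 1 1
  have hinv : ∀ a, φ a⁻¹ = - φ a := fun a => by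
    have := hφ a a⁻¹
    rw [mul_inv_cancel, h1] at this
    omega
  -- The elements of even value, not the kernel, since a trivial kernel would be no contradiction.
  -- This subgroup omits `g` and contains `g * g`, whose value is 2.
  let K : Subgroup G :=
    { carrier := {a | Even (φ a)}
      mul_mem' := fun {a b} ha hb => by
        change Even (φ (a * b))
        rw [hφ]
        exact Even.add ha hb
      one_mem' := by simp [h1]
      inv_mem' := fun {a} ha => by
        change Even (φ a⁻¹)
        rw [hinv]
        exact Even.neg ha }
  have hK : K.Normal := ⟨fun a ha b => by
    change Even (φ (b * a * b⁻¹))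
    rw [hφ, hφ, hinv]
    have : Even (φ a) := ha
    simpa using this⟩
  rcases hG.eq_bot_or_eq_top_of_normal K hK with h | h
  · have h2 : g * g ∈ K := by
      change Even (φ (g * g))
      rw [hφ]
      exact ⟨_, rfl⟩
    rw [h, Subgroup.mem_bot] at h2
    have := hφ g g
    rw [h2, h1, hg] at this
    omega
  · have h2 : g ∈ K := h ▸ Subgroup.mem_top g
    have h3 : Even (φ g) := h2
    rw [hg] at h3
    exact absurd h3 (by decide)

/-- If the stabilizer of a block is not transitive on the block, counting the passages through
blocks at vertices of a given orbit is a nontrivial additive character. -/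
theorem not_isSimpleGroup_of_block (hc : X.Connected) (htr : X.IsTransitive)
    (hB : X.IsBlockSet B) (hx : x ∈ B) (hy : y ∈ B)
    (hxy : ∀ g : X ≃g X, g • B = B → g • x ≠ y) : ¬ IsSimpleGroup (X ≃g X) := by
  classical
  -- The indicator of the orbit of the flag `(x, B)`. It vanishes on sets that are not blocks.
  let c : V → Set V → ℤ := fun v C => if ∃ g : X ≃g X, g • x = v ∧ g • B = C then 1 else 0
  have hcB : ∀ C v, ¬ X.IsBlockSet C → c v C = 0 := fun C v hC =>
    if_neg fun ⟨g, _, h⟩ => hC (h ▸ hB.smul g)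
  have hcg : ∀ (g : X ≃g X) v C, c (g • v) (g • C) = c v C := by
    intro g v C
    refine if_congr ⟨fun ⟨k, h1, h2⟩ => ⟨g⁻¹ * k, ?_, ?_⟩, fun ⟨k, h1, h2⟩ => ⟨g * k, ?_, ?_⟩⟩
      rfl rfl
    · rw [mul_smul, h1, inv_smul_smul]
    · rw [mul_smul, h2, inv_smul_smul]
    · rw [mul_smul, h1]
    · rw [mul_smul, h2]
  let t : V → V → Set V → ℤ := fun a b C => c (X.proj C a) C - c (X.proj C b) C
  have htne : ∀ a b C, t a b C ≠ 0 → X.IsBlockSet C ∧ X.proj C a ≠ X.proj C b := by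
    intro a b C h
    constructor
    · by_contra hC
      exact h (by simp [t, hcB C _ hC])
    · intro hab
      exact h (by simp [t, hab])
  have hfin : ∀ a b, (Function.support (t a b)).Finite := fun a b =>
    (hc.finite_setOf_proj_ne a b).subset fun C hC => htne a b C hC
  let h : V → V → ℤ := fun a b => ∑ᶠ C, t a b C
  have hadd : ∀ a b d, h a d = h a b + h b d := by
    intro a b d
    rw [← finsum_add_distrib (hfin a b) (hfin b d)]
    refine finsum_congr fun C => ?_
    simp [t]
  have hsmul : ∀ (g : X ≃g X) a b, h (g • a) (g • b) = h a b := by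
    intro g a b
    change ∑ᶠ C, t (g • a) (g • b) C = ∑ᶠ C, t a b C
    rw [← finsum_comp_equiv (MulAction.toPerm g : Equiv.Perm (Set V))]
    refine finsum_congr fun C => ?_
    rw [MulAction.toPerm_apply]
    by_cases hC : X.IsBlockSet C
    · simp only [t, hC.proj_smul hc, hcg]
    · have hC' : ¬ X.IsBlockSet (g • C) := fun h => hC ((isBlockSet_smul_iff g).1 h)
      simp only [t, hcB _ _ hC, hcB _ _ hC']
  -- As `x` and `y` both lie in `B`, no other block separates them, and the sum reduces to the term
  -- of `B`, which is 1 - 0.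
  obtain ⟨g, hg⟩ := htr.exists_smul_eq x y
  refine not_isSimpleGroup_of_map_mul_eq_add (fun k => h x (k • x)) (fun a b => ?_) (g := g) ?_
  · rw [mul_smul, hadd x (a • x), hsmul]
  · change ∑ᶠ C, t x (g • x) C = 1
    rw [hg, finsum_eq_single _ B]
    · have h1 : c x B = 1 := if_pos ⟨1, one_smul _ _, one_smul _ _⟩
      have h2 : c y B = 0 := if_neg fun ⟨k, hk1, hk2⟩ => hxy k hk2 hk1
      simp only [t, hB.proj_of_mem hc hx, hB.proj_of_mem hc hy, h1, h2, sub_zero]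
    · intro C hCB
      by_contra h0
      obtain ⟨hC, hne⟩ := htne x y C h0
      exact hne (hC.proj_const hc hB hCB hx hy)

/-- The restriction of an automorphism to a set and its image. -/
def restrictIso (g : X ≃g X) (h : g • S = T) : X.induce S ≃g X.induce T where
  toFun v := ⟨g • v.1, h ▸ Set.smul_mem_smul_set v.2⟩
  invFun v := ⟨g⁻¹ • v.1, by
    rw [← Set.mem_smul_set_iff_inv_smul_mem, h]
    exact v.2⟩
  left_inv v := by simp
  right_inv v := by simp
  map_rel_iff' := by
    intro a b
    exact adj_smul_iff g

theorem not_isSimpleGroup_of_not_isTransitive (hc : X.Connected) (htr : X.IsTransitive)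
    (hB : X.IsBlockSet B) (hn : ¬ (X.induce B).IsTransitive) : ¬ IsSimpleGroup (X ≃g X) := by
  have : ∃ x y : B, ∀ g : X.induce B ≃g X.induce B, g • x ≠ y := by
    by_contra! h
    exact hn ⟨h⟩
  obtain ⟨x, y, hxy⟩ := this
  refine not_isSimpleGroup_of_block hc htr hB x.2 y.2 fun g hg hgx => ?_
  exact hxy (restrictIso g hg) (Subtype.ext hgx)

/-! ### Extending isomorphisms between blocks -/

/-- The relation `J` is the graph of an isomorphism from `X.induce C` to `X.induce C'`. -/
structure IsoRel (X : SimpleGraph V) (C C' : Set V) (J : V → V → Prop) : Prop where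
  mem : ∀ {v v'}, J v v' → v ∈ C ∧ v' ∈ C'
  total : ∀ {v}, v ∈ C → ∃ v', J v v'
  surj : ∀ {v'}, v' ∈ C' → ∃ v, J v v'
  func : ∀ {v v₁ v₂}, J v v₁ → J v v₂ → v₁ = v₂
  inj : ∀ {v₁ v₂ v'}, J v₁ v' → J v₂ v' → v₁ = v₂
  adj : ∀ {v₁ w₁ v₂ w₂}, J v₁ w₁ → J v₂ w₂ → (X.Adj v₁ v₂ ↔ X.Adj w₁ w₂)

/-- The relation `M` is a bijection from the blocks at `u` to those at `u'` that respects `Q`. -/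
structure BlockMatch (X : SimpleGraph V) (Q : Set V → Set V → Prop) (u u' : V)
    (M : Set V → Set V → Prop) : Prop where
  mem : ∀ {C C'}, M C C' → Q C C' ∧ u ∈ C ∧ u' ∈ C'
  total : ∀ {C}, X.IsBlockSet C → u ∈ C → ∃ C', M C C'
  surj : ∀ {C'}, X.IsBlockSet C' → u' ∈ C' → ∃ C, M C C'
  func : ∀ {C C₁ C₂}, M C C₁ → M C C₂ → C₁ = C₂
  inj : ∀ {C₁ C₂ C'}, M C₁ C' → M C₂ C' → C₁ = C₂

theorem IsoRel.flip {J : V → V → Prop} (h : X.IsoRel C C' J) : X.IsoRel C' C (flip J) :=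
  ⟨fun h' => (h.mem h').symm, h.surj, h.total, h.inj, h.func, fun h1 h2 => (h.adj h1 h2).symm⟩

theorem BlockMatch.flip {Q : Set V → Set V → Prop} {M : Set V → Set V → Prop}
    (h : X.BlockMatch Q u u' M) : X.BlockMatch (flip Q) u' u (flip M) :=
  ⟨fun h' => ⟨(h.mem h').1, (h.mem h').2.symm⟩, h.surj, h.total, h.inj, h.func⟩

/-- Choices that determine how an isomorphism between blocks is continued to the neighbouring
blocks: `M u D u' D'` matches the blocks at `u` with those at `u'` and `D` with `D'`, and
`J u C u' C'` is an isomorphism from `C` to `C'` that sends `u` to `u'`. -/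
structure BranchData (X : SimpleGraph V) where
  /-- The pairs of blocks that may be matched. -/
  Q : Set V → Set V → Prop
  /-- The matchings of the blocks at two vertices. -/
  M : V → Set V → V → Set V → Set V → Set V → Prop
  /-- The isomorphisms between blocks. -/
  J : V → Set V → V → Set V → V → V → Prop
  isBlockSet : ∀ {C C'}, Q C C' → X.IsBlockSet C ∧ X.IsBlockSet C'
  match_spec : ∀ {u D u' D'}, Q D D' → u ∈ D → u' ∈ D' →
    X.BlockMatch Q u u' (M u D u' D') ∧ M u D u' D' D D'
  iso_spec : ∀ {u C u' C'}, Q C C' → u ∈ C → u' ∈ C' →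
    X.IsoRel C C' (J u C u' C') ∧ J u C u' C' u u'

namespace BranchData

/-- The data for the inverse isomorphisms. -/
def swap (𝔇 : BranchData X) : BranchData X where
  Q := flip 𝔇.Q
  M u D u' D' := flip (𝔇.M u' D' u D)
  J u C u' C' := flip (𝔇.J u' C' u C)
  isBlockSet h := (𝔇.isBlockSet h).symm
  match_spec h hu hu' := ⟨(𝔇.match_spec h hu' hu).1.flip, (𝔇.match_spec h hu' hu).2⟩
  iso_spec h hu hu' := ⟨(𝔇.iso_spec h hu' hu).1.flip, (𝔇.iso_spec h hu' hu).2⟩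

/-- The continuation of the relation `A` between the blocks `R` and `R'`. Each vertex `v` comes
with the block `C` through which it is reached from `R`. -/
inductive Rel (𝔇 : BranchData X) (R R' : Set V) (A : V → V → Prop) :
    V → Set V → V → Set V → Prop
  | base {v v' : V} : A v v' → Rel 𝔇 R R' A v R v' R'
  -- The conditions `C ≠ D` and `v ≠ u` forbid turning back; they make the continuation
  -- single-valued.
  | step {u u' v v' : V} {D D' C C' : Set V} : Rel 𝔇 R R' A u D u' D' → 𝔇.M u D u' D' C C' → C ≠ D →
      𝔇.J u C u' C' v v' → v ≠ u → Rel 𝔇 R R' A v C v' C'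

variable {𝔇 : BranchData X} {A : V → V → Prop}

theorem Rel.mem (hR : 𝔇.Q R R') (hA : X.IsoRel R R' A) (h : Rel 𝔇 R R' A v C v' C') :
    𝔇.Q C C' ∧ v ∈ C ∧ v' ∈ C' := by
  induction h with
  | base h => exact ⟨hR, hA.mem h⟩
  | step _ hM _ hJ _ ih =>
    obtain ⟨hQ, hu, hu'⟩ := (𝔇.match_spec ih.1 ih.2.1 ih.2.2).1.mem hM
    exact ⟨hQ, (𝔇.iso_spec hQ hu hu').1.mem hJ⟩

theorem Rel.flip (hR : 𝔇.Q R R') (hA : X.IsoRel R R' A) (h : Rel 𝔇 R R' A v C v' C') :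
    Rel 𝔇.swap R' R (flip A) v' C' v C := by
  induction h with
  | base h => exact Rel.base h
  | step hr hM hne hJ hv ih =>
    obtain ⟨hQD, huD, huD'⟩ := hr.mem hR hA
    obtain ⟨hmatch, hD⟩ := 𝔇.match_spec hQD huD huD'
    obtain ⟨hQ, hu, hu'⟩ := hmatch.mem hM
    obtain ⟨hiso, hJu⟩ := 𝔇.iso_spec hQ hu hu'
    refine Rel.step ih hM ?_ hJ ?_
    · rintro rfl
      exact hne (hmatch.inj hM hD)
    · rintro rfl
      exact hv (hiso.inj hJ hJu)

end BranchData

/-- With `R` as root, call `D` the parent block of `u` if `D = R` or `u` is not the vertex of `D`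
nearest to `R`. Every other block at `u` is then entered from the root through `u`. -/
theorem IsBlockSet.proj_eq_of_parent (hc : X.Connected) (hR : X.IsBlockSet R)
    (hC : X.IsBlockSet C) (hD : X.IsBlockSet D) (hCD : C ≠ D) (huC : u ∈ C) (huD : u ∈ D)
    (h : D = R ∨ ∀ r ∈ R, X.proj D r ≠ u) : C ≠ R ∧ ∀ r ∈ R, X.proj C r = u := by
  rcases h with rfl | h
  · refine ⟨hCD, fun r hr => ?_⟩
    rw [hC.proj_const hc hR hCD hr huD, hC.proj_of_mem hc huC]
  · refine ⟨?_, fun r hr => ?_⟩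
    · rintro rfl
      exact h u huC (hD.proj_of_mem hc huD)
    · rw [hD.proj_eq_proj hc hC hCD.symm huD huC, hC.proj_of_mem hc huC]
      rw [hD.proj_of_mem hc huD]
      exact h r hr

theorem IsBlockSet.parent_unique (hc : X.Connected) (hR : X.IsBlockSet R)
    (hC : X.IsBlockSet C) (hD : X.IsBlockSet D) (huC : u ∈ C) (huD : u ∈ D)
    (h : D = R ∨ ∀ r ∈ R, X.proj D r ≠ u) (h' : C = R ∨ ∀ r ∈ R, X.proj C r ≠ u) : C = D := by
  by_contra hCD
  obtain ⟨r, hr⟩ := hR.1.1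
  obtain ⟨h1, h2⟩ := hR.proj_eq_of_parent hc hC hD hCD huC huD h
  exact h'.elim h1 fun h3 => h3 r hr (h2 r hr)

namespace BranchData

variable {𝔇 : BranchData X} {A : V → V → Prop}

theorem Rel.parent (hc : X.Connected) (hR : 𝔇.Q R R') (hA : X.IsoRel R R' A)
    (h : Rel 𝔇 R R' A v C v' C') : C = R ∨ ∀ r ∈ R, X.proj C r ≠ v := by
  induction h with
  | base h => exact Or.inl rfl
  | step hr hM hne hJ hv ih =>
    right
    obtain ⟨hQD, huD, huD'⟩ := hr.mem hR hA
    obtain ⟨hQ, hu, hu'⟩ := (𝔇.match_spec hQD huD huD').1.mem hM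
    intro r hr'
    rw [((𝔇.isBlockSet hR).1.proj_eq_of_parent hc (𝔇.isBlockSet hQ).1 (𝔇.isBlockSet hQD).1 hne hu
      huD ih).2 r hr']
    exact hv.symm

/-- A derivation can be read backwards: the previous vertex is the projection of `R` to `C`, and the
previous block is the parent block of that vertex. -/
theorem Rel.func (hc : X.Connected) (hR : 𝔇.Q R R') (hA : X.IsoRel R R' A)
    (h : Rel 𝔇 R R' A v C v' C') {v₂ : V} {C₂ : Set V} (h₂ : Rel 𝔇 R R' A v C v₂ C₂) :
    v' = v₂ ∧ C' = C₂ := by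
  have hRb := (𝔇.isBlockSet hR).1
  have hstep : ∀ {u D u' D' C C'}, Rel 𝔇 R R' A u D u' D' → 𝔇.M u D u' D' C C' → C ≠ D →
      C ≠ R ∧ ∀ r ∈ R, X.proj C r = u := by
    intro u D u' D' C C' hr hM hne
    obtain ⟨hQD, huD, huD'⟩ := hr.mem hR hA
    obtain ⟨hQ, hu, hu'⟩ := (𝔇.match_spec hQD huD huD').1.mem hM
    exact hRb.proj_eq_of_parent hc (𝔇.isBlockSet hQ).1 (𝔇.isBlockSet hQD).1 hne hu huD
      (hr.parent hc hR hA)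
  induction h generalizing v₂ C₂ with
  | base h =>
    cases h₂ with
    | base h₂ => exact ⟨hA.func h h₂, rfl⟩
    | step hr hM hne hJ hv => exact absurd rfl (hstep hr hM hne).1
  | step hr hM hne hJ hv ih =>
    cases h₂ with
    | base h₂ => exact absurd rfl (hstep hr hM hne).1
    | step hr₂ hM₂ hne₂ hJ₂ hv₂ =>
      obtain ⟨r, hrR⟩ := hRb.1.1
      obtain rfl := ((hstep hr hM hne).2 r hrR).symm.trans ((hstep hr₂ hM₂ hne₂).2 r hrR)
      obtain ⟨hQD, huD, huD'⟩ := hr.mem hR hA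
      obtain ⟨hQD₂, huD₂, huD₂'⟩ := hr₂.mem hR hA
      obtain rfl := hRb.parent_unique hc (𝔇.isBlockSet hQD).1 (𝔇.isBlockSet hQD₂).1 huD huD₂
        (hr₂.parent hc hR hA) (hr.parent hc hR hA)
      obtain ⟨rfl, rfl⟩ := ih hr₂
      have hmatch := (𝔇.match_spec hQD huD huD').1
      obtain rfl := hmatch.func hM hM₂
      obtain ⟨hQ, hu, hu'⟩ := hmatch.mem hM
      exact ⟨(𝔇.iso_spec hQ hu hu').1.func hJ hJ₂, rfl⟩

theorem Rel.func_vertex (hc : X.Connected) (hR : 𝔇.Q R R') (hA : X.IsoRel R R' A)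
    (h : Rel 𝔇 R R' A v C v' C') {v₂ : V} {D D' : Set V} (h₂ : Rel 𝔇 R R' A v D v₂ D') :
    v' = v₂ := by
  obtain ⟨hQ, hv, -⟩ := h.mem hR hA
  obtain ⟨hQ₂, hv₂, -⟩ := h₂.mem hR hA
  obtain rfl := (𝔇.isBlockSet hR).1.parent_unique hc (𝔇.isBlockSet hQ).1 (𝔇.isBlockSet hQ₂).1 hv
    hv₂ (h₂.parent hc hR hA) (h.parent hc hR hA)
  exact (h.func hc hR hA h₂).1

theorem Rel.exists_of_adj (hR : 𝔇.Q R R') (hA : X.IsoRel R R' A)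
    (h : Rel 𝔇 R R' A u D u' D') (huw : X.Adj u w) :
    ∃ E w' E', Rel 𝔇 R R' A w E w' E' ∧ X.Adj u' w' := by
  obtain ⟨E, hE, huE, hwE⟩ := exists_isBlockSet_of_adj huw
  obtain ⟨hQD, huD, huD'⟩ := h.mem hR hA
  by_cases hED : E = D
  · subst hED
    cases h with
    | base h =>
      obtain ⟨w', hw'⟩ := hA.total hwE
      exact ⟨_, w', _, Rel.base hw', (hA.adj h hw').1 huw⟩
    | @step u₀ u₀' _ _ D₀ D₀' _ _ hr hM hne hJ hv =>
      obtain ⟨hQD₀, hu₀, hu₀'⟩ := hr.mem hR hA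
      obtain ⟨hQ, hu, hu'⟩ := (𝔇.match_spec hQD₀ hu₀ hu₀').1.mem hM
      obtain ⟨hiso, hJu⟩ := 𝔇.iso_spec hQ hu hu'
      by_cases hw : w = u₀
      · subst hw
        exact ⟨_, _, _, hr, (hiso.adj hJ hJu).1 huw⟩
      · obtain ⟨w', hw'⟩ := hiso.total hwE
        exact ⟨_, w', _, Rel.step hr hM hne hw' hw, (hiso.adj hJ hw').1 huw⟩
  · obtain ⟨hmatch, hMD⟩ := 𝔇.match_spec hQD huD huD'
    obtain ⟨E', hM⟩ := hmatch.total hE huE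
    obtain ⟨hQ, hu, hu'⟩ := hmatch.mem hM
    obtain ⟨hiso, hJu⟩ := 𝔇.iso_spec hQ hu hu'
    obtain ⟨w', hw'⟩ := hiso.total hwE
    exact ⟨E, w', E', Rel.step h hM hED hw' huw.ne', (hiso.adj hJu hw').1 huw⟩

theorem exists_map (hc : X.Connected) (hR : 𝔇.Q R R') (hA : X.IsoRel R R' A) :
    ∃ φ : V → V, (∀ v, ∃ C C', Rel 𝔇 R R' A v C (φ v) C') ∧
      ∀ u v, X.Adj u v → X.Adj (φ u) (φ v) := by
  obtain ⟨r, hr⟩ := (𝔇.isBlockSet hR).1.1.1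
  obtain ⟨r', hr'⟩ := hA.total hr
  have htot : ∀ v, ∃ v' C C', Rel 𝔇 R R' A v C v' C' := by
    refine hc.pred (P := fun v => ∃ v' C C', Rel 𝔇 R R' A v C v' C') ?_ ⟨r', R, R', Rel.base hr'⟩
    rintro u w huw ⟨u', D, D', h⟩
    obtain ⟨E, w', E', h', -⟩ := h.exists_of_adj hR hA huw
    exact ⟨w', E, E', h'⟩
  choose φ hφ using htot
  refine ⟨φ, hφ, fun u w huw => ?_⟩
  obtain ⟨D, D', h⟩ := hφ u
  obtain ⟨E, w', E', h', hadj⟩ := h.exists_of_adj hR hA huw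
  obtain ⟨_, _, h₂⟩ := hφ w
  rwa [h₂.func_vertex hc hR hA h']

/-- The data and their swap each give an adjacency-preserving map; since flipping a derivation gives
a derivation, uniqueness makes the maps mutually inverse. -/
theorem exists_aut (hc : X.Connected) (hR : 𝔇.Q R R') (hA : X.IsoRel R R' A) :
    ∃ g : X ≃g X, ∀ v v', A v v' → g • v = v' := by
  have hR' : 𝔇.swap.Q R' R := hR
  obtain ⟨φ, hφ, hφa⟩ := exists_map hc hR hA
  obtain ⟨ψ, hψ, hψa⟩ := exists_map hc hR' hA.flip
  have h1 : ∀ v, ψ (φ v) = v := by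
    intro v
    obtain ⟨_, _, h⟩ := hφ v
    obtain ⟨_, _, h'⟩ := hψ (φ v)
    exact h'.func_vertex hc hR' hA.flip (h.flip hR hA)
  have h2 : ∀ v, φ (ψ v) = v := by
    intro v
    obtain ⟨_, _, h⟩ := hψ v
    obtain ⟨_, _, h'⟩ := hφ (ψ v)
    exact h'.func_vertex hc hR hA (h.flip hR' hA.flip)
  refine ⟨⟨⟨φ, ψ, h1, h2⟩, fun {a b} => ⟨fun h => ?_, hφa a b⟩⟩, fun v v' hv => ?_⟩
  · have := hψa _ _ h
    simpa [h1] using this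
  · obtain ⟨_, _, h⟩ := hφ v
    exact h.func_vertex hc hR hA (Rel.base hv)

end BranchData

theorem isoRel_of_iso (β : X.induce C ≃g X.induce C') :
    X.IsoRel C C' (fun v v' => ∃ h : v ∈ C, (β ⟨v, h⟩ : V) = v') where
  mem := by
    rintro v _ ⟨h, rfl⟩
    exact ⟨h, (β ⟨v, h⟩).2⟩
  total {v} h := ⟨_, h, rfl⟩
  surj {v'} h := ⟨β.symm ⟨v', h⟩, (β.symm ⟨v', h⟩).2, by simp⟩
  func := by
    rintro v _ _ ⟨_, rfl⟩ ⟨_, rfl⟩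
    rfl
  inj := by
    rintro v w _ ⟨_, rfl⟩ ⟨_, h⟩
    have := β.injective (Subtype.ext h)
    exact (congrArg Subtype.val this).symm
  adj := by
    rintro v _ w _ ⟨_, rfl⟩ ⟨_, rfl⟩
    exact (β.map_rel_iff (a := ⟨v, _⟩) (b := ⟨w, _⟩)).symm

/-- The pair consists of two isomorphic blocks. -/
def IsoBlocks (X : SimpleGraph V) (C C' : Set V) : Prop :=
  X.IsBlockSet C ∧ X.IsBlockSet C' ∧ Nonempty (X.induce C ≃g X.induce C')

theorem IsoBlocks.symm (h : X.IsoBlocks C C') : X.IsoBlocks C' C :=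
  ⟨h.2.1, h.1, h.2.2.map fun e => e.symm⟩

theorem IsoBlocks.trans (h : X.IsoBlocks C D) (h' : X.IsoBlocks D B) : X.IsoBlocks C B :=
  ⟨h.1, h'.2.1, h.2.2.elim fun e => h'.2.2.map fun e' => e.trans e'⟩

theorem IsBlockSet.isoBlocks_smul (h : X.IsBlockSet C) (g : X ≃g X) : X.IsoBlocks C (g • C) :=
  ⟨h, h.smul g, ⟨restrictIso g rfl⟩⟩

/-- Some automorphism `k` takes `u` to `u'` and the blocks at `u` to those at `u'`; interchanging
the isomorphic blocks `k • D` and `D'` afterwards corrects the image of `D`. -/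
theorem exists_blockMatch (htr : X.IsTransitive) (h : X.IsoBlocks D D') (hu : u ∈ D)
    (hu' : u' ∈ D') : ∃ M, X.BlockMatch X.IsoBlocks u u' M ∧ M D D' := by
  classical
  obtain ⟨k, hk⟩ := htr.exists_smul_eq u u'
  have hkD : X.IsoBlocks (k • D) D' := (h.1.isoBlocks_smul k).symm.trans h
  have hsw : ∀ E, X.IsBlockSet E → u' ∈ E →
      X.IsoBlocks E (Equiv.swap (k • D) D' E) ∧ u' ∈ Equiv.swap (k • D) D' E := by
    intro E hE huE
    by_cases h1 : E = k • D
    · rw [h1, Equiv.swap_apply_left]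
      exact ⟨hkD, hu'⟩
    by_cases h2 : E = D'
    · rw [h2, Equiv.swap_apply_right]
      exact ⟨hkD.symm, hk ▸ Set.smul_mem_smul_set hu⟩
    rw [Equiv.swap_apply_of_ne_of_ne h1 h2]
    exact ⟨⟨hE, hE, ⟨Iso.refl⟩⟩, huE⟩
  refine ⟨fun C C' => X.IsBlockSet C ∧ u ∈ C ∧ Equiv.swap (k • D) D' (k • C) = C', ?_,
    h.1, hu, Equiv.swap_apply_left _ _⟩
  constructor
  · rintro C _ ⟨hC, huC, rfl⟩
    have := hsw (k • C) (hC.smul k) (hk ▸ Set.smul_mem_smul_set huC)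
    exact ⟨(hC.isoBlocks_smul k).trans this.1, huC, this.2⟩
  · exact fun hC hu => ⟨_, hC, hu, rfl⟩
  · intro C' hC' huC'
    obtain ⟨h1, h2⟩ := hsw C' hC' huC'
    refine ⟨k⁻¹ • Equiv.swap (k • D) D' C', h1.2.1.smul k⁻¹, ?_, ?_⟩
    · rw [← hk] at h2
      rwa [Set.mem_inv_smul_set_iff]
    · rw [smul_inv_smul, Equiv.swap_apply_self]
  · rintro C _ _ ⟨_, _, rfl⟩ ⟨_, _, rfl⟩
    rfl
  · rintro C₁ C₂ _ ⟨_, _, rfl⟩ ⟨_, _, h⟩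
    exact smul_left_cancel k ((Equiv.injective _) h).symm

theorem exists_isoRel (hbt : ∀ S, X.IsBlockSet S → (X.induce S).IsTransitive)
    (h : X.IsoBlocks C C') (hu : u ∈ C) (hu' : u' ∈ C') : ∃ J, X.IsoRel C C' J ∧ J u u' := by
  obtain ⟨e⟩ := h.2.2
  obtain ⟨a, ha⟩ := (hbt C' h.2.1).exists_smul_eq (e ⟨u, hu⟩) ⟨u', hu'⟩
  exact ⟨_, isoRel_of_iso (e.trans a), hu, congrArg Subtype.val ha⟩

/-- If all blocks are transitive, every isomorphism between blocks extends to an automorphism. -/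
theorem exists_aut_extending (hc : X.Connected) (htr : X.IsTransitive)
    (hbt : ∀ S, X.IsBlockSet S → (X.induce S).IsTransitive) (hB : X.IsBlockSet B)
    (hC : X.IsBlockSet C) (β : X.induce B ≃g X.induce C) :
    ∃ g : X ≃g X, g • B = C ∧ ∀ v : B, g • (v : V) = β v := by
  -- The hypotheses stand under the existential so that `choose` gives total functions; where they
  -- fail, a dummy relation serves.
  have hM : ∀ u D u' D', ∃ M, X.IsoBlocks D D' → u ∈ D → u' ∈ D' →
      X.BlockMatch X.IsoBlocks u u' M ∧ M D D' := by
    intro u D u' D'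
    by_cases h : X.IsoBlocks D D' ∧ u ∈ D ∧ u' ∈ D'
    · obtain ⟨M, hM⟩ := exists_blockMatch htr h.1 h.2.1 h.2.2
      exact ⟨M, fun _ _ _ => hM⟩
    · exact ⟨fun _ _ => True, fun h1 h2 h3 => absurd ⟨h1, h2, h3⟩ h⟩
  have hJ : ∀ u C u' C', ∃ J, X.IsoBlocks C C' → u ∈ C → u' ∈ C' →
      X.IsoRel C C' J ∧ J u u' := by
    intro u D u' D'
    by_cases h : X.IsoBlocks D D' ∧ u ∈ D ∧ u' ∈ D'
    · obtain ⟨M, hM⟩ := exists_isoRel hbt h.1 h.2.1 h.2.2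
      exact ⟨M, fun _ _ _ => hM⟩
    · exact ⟨fun _ _ => True, fun h1 h2 h3 => absurd ⟨h1, h2, h3⟩ h⟩
  choose M hM using hM
  choose J hJ using hJ
  let 𝔇 : BranchData X :=
    { Q := X.IsoBlocks, M := M, J := J, isBlockSet := fun h => ⟨h.1, h.2.1⟩,
      match_spec := fun {u D u' D'} => hM u D u' D'
      iso_spec := fun {u D u' D'} => hJ u D u' D' }
  obtain ⟨g, hg⟩ := 𝔇.exists_aut hc (R := B) (R' := C) ⟨hB, hC, ⟨β⟩⟩ (isoRel_of_iso β)
  have hg' : ∀ v : B, g • (v : V) = β v := fun v => hg v _ ⟨v.2, rfl⟩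
  refine ⟨g, ?_, hg'⟩
  ext w
  constructor
  · rintro ⟨v, hv, rfl⟩
    have := hg' ⟨v, hv⟩
    change g • v ∈ C
    rw [this]
    exact (β ⟨v, hv⟩).2
  · intro hw
    refine ⟨β.symm ⟨w, hw⟩, (β.symm ⟨w, hw⟩).2, ?_⟩
    change g • _ = w
    rw [hg' (β.symm ⟨w, hw⟩)]
    simp

/-! ### Number of blocks at a vertex and size of blocks -/

theorem exists_isBlockSet_mem (x : V) : ∃ B, X.IsBlockSet B ∧ x ∈ B := by
  have : X.NonSep {x} := ⟨⟨x, rfl⟩, fun D _ P _ a ha b hb hPa => by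
    obtain rfl : a = x := ha.1
    obtain rfl : b = a := hb.1
    exact hPa⟩
  obtain ⟨B, hB, h⟩ := this.exists_isBlockSet
  exact ⟨B, hB, h rfl⟩

/-- If `B` were the only block at `x`, every edge at `x` would lie in `B`. Each other vertex would
then be joined to its projection to `B` without meeting `x`, and `B` minus `x` is connected. -/
theorem IsCutvertex.exists_ne (hc : X.Connected) (hx : X.IsCutvertex x) (hB : X.IsBlockSet B)
    (hxB : x ∈ B) : ∃ C, X.IsBlockSet C ∧ x ∈ C ∧ C ≠ B := by
  by_contra! hcon
  refine hx ((preconnected_iff_connOn (fun v => v ∈ ({x}ᶜ : Set V)) _ (fun _ _ => Iff.rfl)).2 ?_)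
  intro P hP
  have hBP := hB.1.2 {x} Set.subsingleton_singleton P
    fun a ha b hb hab => hP a ha.2 b hb.2 hab
  have hstep : ∀ a b, (X.offGraph B).Adj a b → b ≠ x := by
    rintro a _ hab rfl
    obtain ⟨E, hE, haE, hbE⟩ := exists_isBlockSet_of_adj hab.1
    obtain rfl := hcon E hE hbE
    exact hab.2 ⟨haE, hbE⟩
  have key : ∀ a ≠ x, X.proj B a ≠ x ∧ (P a ↔ P (X.proj B a)) := by
    intro a ha
    obtain ⟨p⟩ := (hc.proj_spec hB.1.1 a).2
    generalize X.proj B a = w at p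
    induction p with
    | nil => exact ⟨ha, Iff.rfl⟩
    | cons hadj q ih =>
      have hb := hstep _ _ hadj
      exact ⟨(ih hb).1, Iff.trans ⟨hP _ ha _ hb hadj.1, hP _ hb _ ha hadj.1.symm⟩ (ih hb).2⟩
  intro a ha b hb hPa
  obtain ⟨ha1, ha2⟩ := key a ha
  obtain ⟨hb1, hb2⟩ := key b hb
  exact hb2.2 (hBP _ ⟨hB.proj_mem hc a, ha1⟩ _ ⟨hB.proj_mem hc b, hb1⟩ (ha2.1 hPa))

theorem HasConnectivityOne.exists_ne (h1 : X.HasConnectivityOne) (htr : X.IsTransitive)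
    (B : Set V) (x : V) : ∃ C, X.IsBlockSet C ∧ x ∈ C ∧ C ≠ B := by
  obtain ⟨hc, c, hcut⟩ := h1
  obtain ⟨g, rfl⟩ := htr.exists_smul_eq c x
  obtain ⟨D, hD, hcD⟩ := exists_isBlockSet_mem (X := X) c
  by_cases h : g • D = B
  · obtain ⟨C, hC, hcC, hne⟩ := hcut.exists_ne hc hD hcD
    refine ⟨g • C, hC.smul g, Set.smul_mem_smul_set hcC, fun h' => hne ?_⟩
    exact smul_left_cancel g (h'.trans h.symm)
  · exact ⟨g • D, hD.smul g, Set.smul_mem_smul_set hcD, h⟩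

/-- A block that is transitive with automorphism group generated by stabilizers has at least three
vertices. -/
theorem IsBlockSet.exists_third (h1 : X.HasConnectivityOne) (htr : X.IsTransitive)
    (hB : X.IsBlockSet B) (hBt : (X.induce B).IsTransitive)
    (hBs : (X.induce B).AutGeneratedByStabilizers) {a : V} (ha : a ∈ B) (b : V) :
    ∃ d ∈ B, d ≠ a ∧ d ≠ b := by
  by_contra! hcon
  -- On at most two vertices a vertex stabilizer is trivial, hence so is the group they generate.
  -- Transitivity then leaves a single vertex, which another block contains, against maximality.
  have htriv : ∀ α : X.induce B ≃g X.induce B, α = 1 := by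
    intro α
    have hα : α ∈ ⨆ v : B, MulAction.stabilizer (X.induce B ≃g X.induce B) v := by
      rw [show _ = _ from hBs]
      exact Subgroup.mem_top α
    have hbot : ⨆ v : B, MulAction.stabilizer (X.induce B ≃g X.induce B) v ≤ ⊥ := by
      refine iSup_le fun v α hα => ?_
      rw [Subgroup.mem_bot]
      have hv : α v = v := hα
      ext w
      change ((α w : B) : V) = w
      by_cases hwv : w = v
      · rw [hwv, hv]
      · have h3 : α w ≠ v := fun h => hwv (α.injective (h.trans hv.symm))
        have h4 : ((α w : B) : V) ≠ v := fun h => h3 (Subtype.ext h)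
        have h5 : (w : V) ≠ v := fun h => hwv (Subtype.ext h)
        have h6 := hcon _ (α w).2
        have h7 := hcon _ w.2
        have h8 := hcon _ v.2
        by_cases h9 : (v : V) = a
        · rw [h6 (h9 ▸ h4), h7 (h9 ▸ h5)]
        · have h10 := h8 h9
          rw [not_imp_comm.1 h6 (h10 ▸ h4), not_imp_comm.1 h7 (h10 ▸ h5)]
    exact Subgroup.mem_bot.1 (hbot hα)
  have hsub : B ⊆ {a} := by
    intro v hv
    obtain ⟨α, hα⟩ := hBt.exists_smul_eq ⟨v, hv⟩ ⟨a, ha⟩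
    rw [htriv α, one_smul] at hα
    exact congrArg Subtype.val hα
  obtain ⟨C, hC, haC, hne⟩ := h1.exists_ne htr B a
  have hBC : B ⊆ C := hsub.trans (Set.singleton_subset_iff.2 haC)
  exact hne (hB.2 hC.1 hBC |>.antisymm hBC)

/-! ### Constructing automorphisms piecewise -/

/-- The automorphism with given underlying map and inverse map. -/
def autOfMaps (φ ψ : V → V) (h1 : ∀ v, ψ (φ v) = v) (h2 : ∀ v, φ (ψ v) = v)
    (hφ : ∀ u v, X.Adj u v → X.Adj (φ u) (φ v)) (hψ : ∀ u v, X.Adj u v → X.Adj (ψ u) (ψ v)) :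
    X ≃g X where
  toFun := φ
  invFun := ψ
  left_inv := h1
  right_inv := h2
  map_rel_iff' {a b} := ⟨fun h => by
    have := hψ _ _ h
    simpa [h1] using this, hφ a b⟩

section Piecewise

variable {ι : Type*}

open Classical in
/-- The map that is `a i` on `S i` and the identity outside of all the `S i`. -/
noncomputable def piecewiseMap (S : ι → Set V) (a : ι → X ≃g X) (v : V) : V :=
  if h : ∃ i, v ∈ S i then a h.choose • v else v

theorem piecewiseMap_of_mem {S : ι → Set V} (hS : ∀ i j v, v ∈ S i → v ∈ S j → i = j)
    (a : ι → X ≃g X) {i : ι} (hv : v ∈ S i) :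
    piecewiseMap S a v = a i • v := by
  have h : ∃ i, v ∈ S i := ⟨i, hv⟩
  rw [piecewiseMap, dif_pos h, hS _ _ v h.choose_spec hv]

theorem piecewiseMap_of_not_mem {S : ι → Set V} (a : ι → X ≃g X) (hv : ∀ i, v ∉ S i) :
    piecewiseMap S a v = v :=
  dif_neg fun ⟨i, hi⟩ => hv i hi

theorem piecewiseMap_adj {S : ι → Set V} (hS : ∀ i j v, v ∈ S i → v ∈ S j → i = j)
    (a : ι → X ≃g X)
    (hbd : ∀ i u v, u ∈ S i → v ∉ S i → X.Adj u v → a i • u = u) (h : X.Adj u v) :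
    X.Adj (piecewiseMap S a u) (piecewiseMap S a v) := by
  by_cases huv : ∃ i, u ∈ S i ∧ v ∈ S i
  · obtain ⟨i, hu, hv⟩ := huv
    rw [piecewiseMap_of_mem hS a hu, piecewiseMap_of_mem hS a hv]
    exact (adj_smul_iff _).2 h
  have key : ∀ u v, X.Adj u v → (¬ ∃ i, u ∈ S i ∧ v ∈ S i) → piecewiseMap S a u = u := by
    intro u v h huv
    by_cases hu : ∃ i, u ∈ S i
    · obtain ⟨i, hi⟩ := hu
      rw [piecewiseMap_of_mem hS a hi]
      exact hbd i u v hi (fun hv => huv ⟨i, hi, hv⟩) h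
    · exact piecewiseMap_of_not_mem a fun i hi => hu ⟨i, hi⟩
  rwa [key u v h huv, key v u h.symm fun ⟨i, h1, h2⟩ => huv ⟨i, h2, h1⟩]

theorem piecewiseMap_inv {S : ι → Set V} (hS : ∀ i j v, v ∈ S i → v ∈ S j → i = j)
    (a : ι → X ≃g X) (hinv : ∀ i v, v ∈ S i → a i • v ∈ S i) (v : V) :
    piecewiseMap S (fun i => (a i)⁻¹) (piecewiseMap S a v) = v := by
  by_cases hv : ∃ i, v ∈ S i
  · obtain ⟨i, hi⟩ := hv
    rw [piecewiseMap_of_mem hS a hi, piecewiseMap_of_mem hS _ (hinv i v hi), inv_smul_smul]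
  · have hv : ∀ i, v ∉ S i := fun i hi => hv ⟨i, hi⟩
    rw [piecewiseMap_of_not_mem a hv, piecewiseMap_of_not_mem _ hv]

/-- Each piece is preserved and its boundary vertices are fixed, so edges between pieces survive.
The family may be infinite, which permits infinite products of automorphisms. -/
theorem exists_piecewise {S : ι → Set V} (hS : ∀ i j v, v ∈ S i → v ∈ S j → i = j)
    (a : ι → X ≃g X) (hinv : ∀ i v, a i • v ∈ S i ↔ v ∈ S i)
    (hbd : ∀ i u v, u ∈ S i → v ∉ S i → X.Adj u v → a i • u = u) :
    ∃ g : X ≃g X, (∀ i v, v ∈ S i → g • v = a i • v) ∧ ∀ v, (∀ i, v ∉ S i) → g • v = v := by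
  have hinv' : ∀ i v, v ∈ S i → (a i)⁻¹ • v ∈ S i := fun i v hv => by
    rwa [← hinv i, smul_inv_smul]
  have hbd' : ∀ i u v, u ∈ S i → v ∉ S i → X.Adj u v → (a i)⁻¹ • u = u := fun i u v h1 h2 h3 => by
    rw [inv_smul_eq_iff, hbd i u v h1 h2 h3]
  refine ⟨autOfMaps (piecewiseMap S a) (piecewiseMap S fun i => (a i)⁻¹)
    (piecewiseMap_inv hS a fun i v => (hinv i v).2) (fun v => ?_)
    (fun _ _ => piecewiseMap_adj hS a hbd)
    (fun _ _ => piecewiseMap_adj hS _ hbd'), fun i v hv => ?_, fun v hv => ?_⟩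
  · have := piecewiseMap_inv hS (fun i => (a i)⁻¹) hinv' v
    simpa only [inv_inv] using this
  · exact piecewiseMap_of_mem hS a hv
  · exact piecewiseMap_of_not_mem a hv

end Piecewise

/-! ### The subgroup generated by the flag stabilizers -/

/-- The subgroup generated by the automorphisms that fix a vertex and a block containing it. -/
def flagSubgroup (X : SimpleGraph V) : Subgroup (X ≃g X) :=
  Subgroup.closure {g | ∃ B x, X.IsBlockSet B ∧ x ∈ B ∧ g • B = B ∧ g • x = x}

theorem IsBlockSet.mem_flagSubgroup (hB : X.IsBlockSet B) (hx : x ∈ B) {g : X ≃g X}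
    (hg : g • B = B) (hgx : g • x = x) : g ∈ X.flagSubgroup :=
  Subgroup.subset_closure ⟨B, x, hB, hx, hg, hgx⟩

instance flagSubgroup_normal : X.flagSubgroup.Normal := by
  refine ⟨fun n hn g => ?_⟩
  induction hn using Subgroup.closure_induction with
  | mem k hk =>
    obtain ⟨B, x, hB, hx, hkB, hkx⟩ := hk
    refine (hB.smul g).mem_flagSubgroup (Set.smul_mem_smul_set hx) ?_ ?_
    · rw [mul_smul, mul_smul, inv_smul_smul, hkB]
    · rw [mul_smul, mul_smul, inv_smul_smul, hkx]
  | one => simp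
  | mul a b _ _ ha hb =>
    have := mul_mem ha hb
    rwa [show g * a * g⁻¹ * (g * b * g⁻¹) = g * (a * b) * g⁻¹ by group] at this
  | inv a _ ha =>
    have := inv_mem ha
    rwa [show (g * a * g⁻¹)⁻¹ = g * a⁻¹ * g⁻¹ by group] at this

/-- The hypotheses under which simplicity is proved. -/
structure StabGenerated (X : SimpleGraph V) : Prop where
  isTransitive : X.IsTransitive
  hasConnectivityOne : X.HasConnectivityOne
  block_isTransitive : ∀ S, X.IsBlockSet S → (X.induce S).IsTransitive
  block_generated : ∀ S, X.IsBlockSet S → (X.induce S).AutGeneratedByStabilizers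

namespace StabGenerated

theorem connected (hX : X.StabGenerated) : X.Connected := hX.hasConnectivityOne.1

/-- Here generation by stabilizers enters: an extension of an element fixing a vertex of `B` is
itself a flag stabilizer element, and products of extensions extend products. -/
theorem exists_extension (hX : X.StabGenerated) (hB : X.IsBlockSet B)
    (α : X.induce B ≃g X.induce B) :
    ∃ g ∈ X.flagSubgroup, g • B = B ∧ ∀ v : B, g • (v : V) = α v := by
  have hα : α ∈ ⨆ v : B, MulAction.stabilizer (X.induce B ≃g X.induce B) v := by
    rw [show _ = _ from hX.block_generated B hB]
    exact Subgroup.mem_top α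
  induction hα using Subgroup.iSup_induction' with
  | hp x α hα =>
    obtain ⟨g, hgB, hg⟩ := exists_aut_extending hX.connected hX.isTransitive hX.block_isTransitive
      hB hB α
    refine ⟨g, hB.mem_flagSubgroup x.2 hgB ?_, hgB, hg⟩
    rw [hg, show α x = x from hα]
  | h1 => exact ⟨1, one_mem _, one_smul _ _, fun v => one_smul _ _⟩
  | hmul α β _ _ hα hβ =>
    obtain ⟨g, hg, hgB, hgv⟩ := hα
    obtain ⟨k, hk, hkB, hkv⟩ := hβ
    refine ⟨g * k, mul_mem hg hk, by rw [mul_smul, hkB, hgB], fun v => ?_⟩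
    rw [mul_smul, hkv, hgv]
    rfl

theorem exists_smul_eq_of_mem (hX : X.StabGenerated) (hB : X.IsBlockSet B) (hu : u ∈ B)
    (hv : v ∈ B) :
    ∃ g ∈ X.flagSubgroup, g • B = B ∧ g • u = v := by
  obtain ⟨α, hα⟩ := (hX.block_isTransitive B hB).exists_smul_eq ⟨u, hu⟩ ⟨v, hv⟩
  obtain ⟨g, hg, hgB, hgv⟩ := hX.exists_extension hB α
  refine ⟨g, hg, hgB, ?_⟩
  rw [hgv ⟨u, hu⟩]
  exact congrArg Subtype.val hα

theorem exists_smul_eq (hX : X.StabGenerated) (u v : V) : ∃ g ∈ X.flagSubgroup, g • u = v := by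
  refine hX.connected.pred (P := fun v => ∃ g ∈ X.flagSubgroup, g • u = v) ?_
    ⟨1, one_mem _, one_smul _ _⟩ v
  rintro a b hab ⟨g, hg, rfl⟩
  obtain ⟨B, hB, ha, hb⟩ := exists_isBlockSet_of_adj hab
  obtain ⟨k, hk, -, hk2⟩ := hX.exists_smul_eq_of_mem hB ha hb
  exact ⟨k * g, mul_mem hk hg, by rw [mul_smul, hk2]⟩

theorem exists_third (hX : X.StabGenerated) (hB : X.IsBlockSet B) (ha : u ∈ B) (v : V) :
    ∃ d ∈ B, d ≠ u ∧ d ≠ v :=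
  hB.exists_third hX.hasConnectivityOne hX.isTransitive (hX.block_isTransitive B hB)
    (hX.block_generated B hB) ha v

end StabGenerated

/-! ### Normal subgroups -/

/-- The automorphism `g` moves the block `B` into the branch at its vertex `z`. -/
def Beyond (X : SimpleGraph V) (B : Set V) (g : X ≃g X) (z : V) : Prop :=
  ∀ b ∈ B, X.proj B (g • b) = z

theorem IsBlockSet.exists_beyond (hc : X.Connected) (hB : X.IsBlockSet B) {g : X ≃g X}
    (hg : g • B ≠ B) : ∃ z ∈ B, X.Beyond B g z := by
  obtain ⟨b, hb⟩ := hB.1.1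
  refine ⟨X.proj B (g • b), hB.proj_mem hc _, fun c hcB => ?_⟩
  exact hB.proj_const hc (hB.smul g) hg.symm (Set.smul_mem_smul_set hcB) (Set.smul_mem_smul_set hb)

theorem Beyond.conj (hc : X.Connected) (hB : X.IsBlockSet B) {g k : X ≃g X} (h : X.Beyond B g z)
    (hk : k • B = B) : X.Beyond B (k * g * k⁻¹) (k • z) := by
  intro b hb
  have hb' : k⁻¹ • b ∈ B := by rwa [← Set.mem_smul_set_iff_inv_smul_mem, hk]
  have := hB.proj_smul hc k (g • k⁻¹ • b)
  rw [hk, h _ hb'] at this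
  rw [mul_smul, mul_smul, this]

namespace StabGenerated

theorem smul_ne_of_beyond (hX : X.StabGenerated) (hB : X.IsBlockSet B) {g : X ≃g X}
    (h : X.Beyond B g z) :
    g • B ≠ B := by
  intro hg
  obtain ⟨b, hb⟩ := hB.1.1
  have key : ∀ d ∈ B, d = z := by
    intro d hd
    rw [← hg] at hd
    obtain ⟨e, he, rfl⟩ := hd
    have h1 := h e he
    have h2 : g • e ∈ B := hg ▸ Set.smul_mem_smul_set he
    rwa [hB.proj_of_mem hX.connected h2] at h1
  obtain ⟨d, hd, hne, -⟩ := hX.exists_third hB hb b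
  exact hne ((key d hd).trans (key b hb).symm)

/-- The ping-pong step. The block `g⁻¹ • B` lies in the branch at `z'` and `v` does not, so `g⁻¹ •
B` sees `v` in the direction of `B`. Applying `g`, the block `B` sees `g • v` in the direction of `g
• B`. -/
theorem proj_smul_eq (hX : X.StabGenerated) (hB : X.IsBlockSet B) {g : X ≃g X} (h : X.Beyond B g z)
    (h' : X.Beyond B g⁻¹ z') (hv : X.proj B v ≠ z') : X.proj B (g • v) = z := by
  have hc := hX.connected
  obtain ⟨b, hb⟩ := hB.1.1
  have hne := hX.smul_ne_of_beyond hB h'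
  have hB' := hB.smul g⁻¹
  have h1 : X.proj (g⁻¹ • B) v = X.proj (g⁻¹ • B) b :=
    hB.proj_eq_proj hc hB' hne.symm hb (Set.smul_mem_smul_set hb) (by rwa [h' b hb])
  have h2 := hB'.proj_smul hc g v
  have h3 := hB'.proj_smul hc g b
  rw [smul_inv_smul] at h2 h3
  rw [h2, h1, ← h3, h b hb]

/-- If `N` preserved `B`, it would preserve the translates of `B` under `flagSubgroup`. One of
these, attached through another block at `x`, projects to `x` in `B`, so `N` would fix `x` and, by
conjugation, every vertex. -/
theorem exists_smul_ne (hX : X.StabGenerated) {N : Subgroup (X ≃g X)}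
    (hN : ∀ k ∈ X.flagSubgroup, ∀ n ∈ N, k * n * k⁻¹ ∈ N) (hN1 : N ≠ ⊥)
    (hB : X.IsBlockSet B) : ∃ g ∈ N, g • B ≠ B := by
  by_contra! hcon
  have hc := hX.connected
  have hconj : ∀ k ∈ X.flagSubgroup, ∀ n ∈ N, k⁻¹ * n * k ∈ N := fun k hk n hn => by
    simpa using hN k⁻¹ (inv_mem hk) n hn
  obtain ⟨x, hx⟩ := hB.1.1
  obtain ⟨C, hC, hxC, hne⟩ := hX.hasConnectivityOne.exists_ne hX.isTransitive B x
  obtain ⟨z, hzC, hzx, -⟩ := hX.exists_third hC hxC x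
  obtain ⟨k, hk, hkC, hkx⟩ := hX.exists_smul_eq_of_mem hC hxC hzC
  have hzk : z ∈ k • B := hkx ▸ Set.smul_mem_smul_set hx
  have hkB : B ≠ k • B := by
    intro h
    rw [← h] at hzk
    exact hzx (hB.eq_of_mem hC hne.symm hzk hzC hx hxC)
  have hprojz : X.proj B z = x := by
    rw [hB.proj_const hc hC hne.symm hzC hxC, hB.proj_of_mem hc hx]
  have hfix : ∀ n ∈ N, n • x = x := by
    intro n hn
    have h1 : n • B = B := hcon n hn
    have h2 : n • k • B = k • B := by
      have := hcon _ (hconj k hk n hn)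
      rwa [mul_smul, mul_smul, inv_smul_eq_iff] at this
    have h3 := hB.proj_smul hc n z
    rw [h1, hprojz] at h3
    rw [← h3, ← hprojz]
    exact hB.proj_const hc (hB.smul k) hkB (h2 ▸ Set.smul_mem_smul_set hzk) hzk
  refine hN1 ((Subgroup.eq_bot_iff_forall _).2 fun n hn => ?_)
  ext y
  obtain ⟨k, hk, rfl⟩ := hX.exists_smul_eq x y
  have := hfix _ (hconj k hk n hn)
  rwa [mul_smul, mul_smul, inv_smul_eq_iff] at this

/-- If `g` and its inverse send `B` into the same branch at `z`, conjugate `g` by some `k`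
preserving `B` and moving `z`. By ping-pong the product of `(k * g * k⁻¹)⁻¹` and `g` has the two
distinct directions `k • z` and `z`. -/
theorem exists_beyond (hX : X.StabGenerated) {N : Subgroup (X ≃g X)}
    (hN : ∀ k ∈ X.flagSubgroup, ∀ n ∈ N, k * n * k⁻¹ ∈ N) (hN1 : N ≠ ⊥)
    (hB : X.IsBlockSet B) :
    ∃ f ∈ N, ∃ z ∈ B, ∃ z' ∈ B, z ≠ z' ∧ X.Beyond B f z ∧ X.Beyond B f⁻¹ z' := by
  have hc := hX.connected
  obtain ⟨g, hg, hgB⟩ := hX.exists_smul_ne hN hN1 hB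
  have hgB' : g⁻¹ • B ≠ B := fun h => hgB (inv_smul_eq_iff.1 h).symm
  obtain ⟨z, hz, hgz⟩ := hB.exists_beyond hc hgB
  obtain ⟨z', hz', hgz'⟩ := hB.exists_beyond hc hgB'
  by_cases hzz : z = z'
  swap
  · exact ⟨g, hg, z, hz, z', hz', hzz, hgz, hgz'⟩
  subst hzz
  obtain ⟨y, hy, hyz, -⟩ := hX.exists_third hB hz z
  obtain ⟨k, hk, hkB, rfl⟩ := hX.exists_smul_eq_of_mem hB hz hy
  have h1 : X.Beyond B (k * g * k⁻¹) (k • z) := hgz.conj hc hB hkB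
  have h2 : X.Beyond B (k * g * k⁻¹)⁻¹ (k • z) := by
    have := hgz'.conj hc hB hkB
    rwa [show (k * g * k⁻¹)⁻¹ = k * g⁻¹ * k⁻¹ by group]
  refine ⟨(k * g * k⁻¹)⁻¹ * g, mul_mem (inv_mem (hN k hk g hg)) hg, k • z, hy, z, hz, hyz,
    fun b hb => ?_, fun b hb => ?_⟩
  · rw [mul_smul]
    refine hX.proj_smul_eq hB h2 (by rwa [inv_inv]) ?_
    rw [hgz b hb]
    exact hyz.symm
  · rw [mul_inv_rev, inv_inv, mul_smul]
    refine hX.proj_smul_eq hB hgz' (by rwa [inv_inv]) ?_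
    rw [h1 b hb]
    exact hyz

/-- A third vertex of `B`, off both directions of `f`, is moved to `x` by conjugation. -/
theorem exists_beyond_avoiding (hX : X.StabGenerated) {N : Subgroup (X ≃g X)}
    (hN : ∀ k ∈ X.flagSubgroup, ∀ n ∈ N, k * n * k⁻¹ ∈ N) (hN1 : N ≠ ⊥)
    (hB : X.IsBlockSet B) (hx : x ∈ B) :
    ∃ f ∈ N, ∃ z z', z' ∈ B ∧ z ≠ z' ∧ z ≠ x ∧ z' ≠ x ∧ X.Beyond B f z ∧ X.Beyond B f⁻¹ z' := by
  have hc := hX.connected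
  obtain ⟨f, hf, z, hz, z', hz', hne, h, h'⟩ := hX.exists_beyond hN hN1 hB
  obtain ⟨y, hy, hyz, hyz'⟩ := hX.exists_third hB hz z'
  obtain ⟨k, hk, hkB, rfl⟩ := hX.exists_smul_eq_of_mem hB hy hx
  refine ⟨k * f * k⁻¹, hN k hk f hf, k • z, k • z', hkB ▸ Set.smul_mem_smul_set hz', ?_, ?_, ?_,
    h.conj hc hB hkB, ?_⟩
  · exact fun h => hne (smul_left_cancel k h)
  · exact fun h => hyz (smul_left_cancel k h).symm
  · exact fun h => hyz' (smul_left_cancel k h).symm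
  · have := h'.conj hc hB hkB
    rwa [show (k * f * k⁻¹)⁻¹ = k * f⁻¹ * k⁻¹ by group]

/-- An automorphism that acts only on the branch at the vertex `x` of a block is a commutator of
an element of `N` that translates along a line avoiding this branch. -/
theorem mem_of_fixes (hX : X.StabGenerated) {N : Subgroup (X ≃g X)}
    (hN : ∀ k ∈ X.flagSubgroup, ∀ n ∈ N, k * n * k⁻¹ ∈ N) (hN1 : N ≠ ⊥)
    (hB : X.IsBlockSet B) (hx : x ∈ B) {k : X ≃g X} (hkx : k • x = x)
    (hk : ∀ v, X.proj B v ≠ x → k • v = v) : k ∈ N := by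
  have hc := hX.connected
  obtain ⟨f, hf, z, z', hz', hzz', hzx, hz'x, hfz, hfz'⟩ :=
    hX.exists_beyond_avoiding hN hN1 hB hx
  set W : Set V := {v | X.proj B v = x} with hW
  have hkW : ∀ v, k • v ∈ W ↔ v ∈ W := by
    intro v
    have h2 : ∀ w, w ∉ W → k • w = w := fun w hw => hk w hw
    constructor
    · intro h
      by_contra hv
      rw [h2 v hv] at h
      exact hv h
    · intro h
      by_contra hv
      have := smul_left_cancel k (h2 _ hv)
      rw [this] at hv
      exact hv h
  have hpow : ∀ (i : ℕ) (v : V), v ∈ W → X.proj B (f ^ (i + 1) • v) = z := by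
    intro i v hv
    induction i with
    | zero =>
      rw [zero_add, pow_one]
      refine hX.proj_smul_eq hB hfz hfz' ?_
      rw [show X.proj B v = x from hv]
      exact hz'x.symm
    | succ i ih =>
      rw [pow_succ', mul_smul]
      refine hX.proj_smul_eq hB hfz hfz' ?_
      rwa [ih]
  have hlt : ∀ i j v, i < j → v ∈ f ^ i • W → v ∉ f ^ j • W := by
    rintro i j _ hij hi ⟨w, hw, rfl⟩
    obtain ⟨m, rfl⟩ := Nat.exists_eq_add_of_lt hij
    rw [Set.mem_smul_set_iff_inv_smul_mem] at hi
    have h1 : (f ^ i)⁻¹ • f ^ (i + m + 1) • w = f ^ (m + 1) • w := by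
      rw [add_assoc, pow_add, mul_smul, inv_smul_smul]
    have h2 : X.proj B (f ^ (m + 1) • w) = x := h1 ▸ hi
    rw [hpow m w hw] at h2
    exact hzx h2
  have hdisj : ∀ i j v, v ∈ f ^ i • W → v ∈ f ^ j • W → i = j := by
    intro i j v hi hj
    rcases lt_trichotomy i j with h | h | h
    · exact absurd hj (hlt i j v h hi)
    · exact h
    · exact absurd hi (hlt j i v h hj)
  -- The infinite product of the conjugates `f ^ i * k * (f ^ i)⁻¹` over all `i ≥ 0`, acting on the
  -- disjoint translates of the branch `W`.
  obtain ⟨k', hk'1, hk'2⟩ := exists_piecewise (X := X) hdisj (fun i => f ^ i * k * (f ^ i)⁻¹)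
    (by
      intro i v
      rw [Set.mem_smul_set_iff_inv_smul_mem, Set.mem_smul_set_iff_inv_smul_mem, mul_smul,
        mul_smul, inv_smul_smul, hkW])
    (by
      intro i u v hu hv huv
      rw [Set.mem_smul_set_iff_inv_smul_mem] at hu hv
      have h1 : X.Adj ((f ^ i)⁻¹ • u) ((f ^ i)⁻¹ • v) := (adj_smul_iff _).2 huv
      have h2 : (f ^ i)⁻¹ • u ∈ B := by
        by_contra hn
        refine hv ?_
        have := hB.proj_eq_of_adj hc h1 fun h => hn h.1
        exact this.symm.trans hu
      have h3 : (f ^ i)⁻¹ • u = x := (hB.proj_of_mem hc h2).symm.trans hu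
      rw [mul_smul, mul_smul, h3, hkx, ← h3, smul_inv_smul])
  have hz'0 : ∀ i, z' ∉ f ^ i • W := by
    intro i hi
    obtain ⟨w, hw, hwz⟩ := hi
    have hwz : f ^ i • w = z' := hwz
    have h1 := hB.proj_of_mem hc hz'
    rw [← hwz] at h1
    cases i with
    | zero =>
      rw [pow_zero, one_smul] at h1 hwz
      exact hz'x (hwz.symm.trans (h1.symm.trans hw))
    | succ i =>
      rw [hpow i w hw, hwz] at h1
      exact hzz' h1
  have hxW : x ∈ f ^ 0 • W := by
    rw [pow_zero, one_smul]
    exact hB.proj_of_mem hc hx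
  have hk'x : k' • x = x := by
    rw [hk'1 0 x hxW]
    simpa using hkx
  have hk'z : k' • z' = z' := hk'2 z' hz'0
  -- `B` is the only block containing both of the fixed vertices `x` and `z'`.
  have hk'B : k' • B = B := by
    by_contra hne
    refine hz'x ((hB.smul k').eq_of_mem hB hne ?_ hz' ?_ hx)
    · exact Set.mem_smul_set.2 ⟨z', hz', hk'z⟩
    · exact Set.mem_smul_set.2 ⟨x, hx, hk'x⟩
  have hk' : k' ∈ X.flagSubgroup := hB.mem_flagSubgroup hx hk'B hk'x
  have hsucc : ∀ i v, f⁻¹ • v ∈ f ^ i • W ↔ v ∈ f ^ (i + 1) • W := by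
    intro i v
    rw [← Set.mem_smul_set_iff_inv_smul_mem, ← mul_smul, ← pow_succ']
  have hnot0 : ∀ v, v ∉ f ^ 0 • W → k • v = v := by
    intro v hv
    rw [pow_zero, one_smul] at hv
    exact hk v hv
  -- Conjugation by `f` shifts the product and loses the factor with `i = 0`, which is `k`. Hence
  -- `k` is the commutator of `k'` and `f`.
  have heq : k * (f * k' * f⁻¹) = k' := by
    ext v
    change (k * (f * k' * f⁻¹)) • v = k' • v
    rw [mul_smul, mul_smul, mul_smul]
    by_cases hv : ∃ i, v ∈ f ^ i • W
    · obtain ⟨i, hi⟩ := hv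
      cases i with
      | zero =>
        have h1 : ∀ j, f⁻¹ • v ∉ f ^ j • W := by
          intro j hj
          rw [hsucc] at hj
          exact absurd (hdisj _ _ v hi hj) (by omega)
        rw [hk'2 _ h1, hk'1 0 v hi, smul_inv_smul]
        simp
      | succ i =>
        have h1 := (hsucc i v).2 hi
        have h2 : f • k' • f⁻¹ • v = k' • v := by
          rw [hk'1 i _ h1, hk'1 _ v hi, ← mul_smul, ← mul_smul]
          congr 1
          rw [pow_succ']
          group
        rw [h2]
        refine hnot0 _ fun h => ?_
        have h3 : k' • v ∈ f ^ (i + 1) • W := by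
          rw [hk'1 _ v hi]
          rw [Set.mem_smul_set_iff_inv_smul_mem] at hi
          rw [Set.mem_smul_set_iff_inv_smul_mem, mul_smul, mul_smul, inv_smul_smul, hkW]
          exact hi
        exact absurd (hdisj _ _ _ h h3) (by omega)
    · have hv : ∀ i, v ∉ f ^ i • W := fun i hi => hv ⟨i, hi⟩
      have h1 : ∀ j, f⁻¹ • v ∉ f ^ j • W := fun j hj => hv _ ((hsucc j v).1 hj)
      rw [hk'2 _ h1, smul_inv_smul, hk'2 v hv]
      exact hnot0 v (hv 0)
  have hkeq : k = k' * f * k'⁻¹ * f⁻¹ := by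
    rw [eq_mul_inv_of_mul_eq heq]
    group
  rw [hkeq]
  exact mul_mem (hN k' hk' f hf) (inv_mem hf)

/-- An element `g` fixing `x` and `B` is split as `k * (k⁻¹ * g)`, where `k` is `g` on the branch at
`x` of `B` and the identity elsewhere. The other factor moves only vertices whose projection to `B`
is not `x`; these lie in the branch at `x` of a second block `C`. -/
theorem flagSubgroup_le (hX : X.StabGenerated) {N : Subgroup (X ≃g X)}
    (hN : ∀ k ∈ X.flagSubgroup, ∀ n ∈ N, k * n * k⁻¹ ∈ N) (hN1 : N ≠ ⊥) : X.flagSubgroup ≤ N := by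
  have hc := hX.connected
  refine (Subgroup.closure_le _).2 ?_
  rintro g ⟨B, x, hB, hx, hgB, hgx⟩
  have hgW : ∀ v, X.proj B (g • v) = x ↔ X.proj B v = x := by
    intro v
    have := hB.proj_smul hc g v
    rw [hgB] at this
    rw [this]
    exact ⟨fun h => smul_left_cancel g (h.trans hgx.symm), fun h => by rw [h, hgx]⟩
  obtain ⟨k, hk1, hk2⟩ := exists_piecewise (X := X) (S := fun _ : Unit => {v | X.proj B v = x})
    (fun _ _ _ _ _ => rfl) (fun _ => g) (fun _ v => hgW v)
    (by
      intro _ u v hu hv huv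
      have h2 : u ∈ B := by
        by_contra hn
        refine hv ?_
        have := hB.proj_eq_of_adj hc huv fun h => hn h.1
        exact this.symm.trans hu
      have h3 : u = x := (hB.proj_of_mem hc h2).symm.trans hu
      rw [h3, hgx])
  have hkx : k • x = x := (hk1 () x (hB.proj_of_mem hc hx)).trans hgx
  have hkN : k ∈ N := hX.mem_of_fixes hN hN1 hB hx hkx fun v hv => hk2 v fun _ => hv
  obtain ⟨C, hC, hxC, hne⟩ := hX.hasConnectivityOne.exists_ne hX.isTransitive B x
  have hmem : k⁻¹ * g ∈ N := by
    refine hX.mem_of_fixes hN hN1 hC hxC ?_ fun v hv => ?_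
    · rw [mul_smul, hgx, inv_smul_eq_iff, hkx]
    · rw [mul_smul, inv_smul_eq_iff]
      refine (hk1 () v ?_).symm
      have h1 : X.proj C v ≠ X.proj C x := by rwa [hC.proj_of_mem hc hxC]
      exact (hC.proj_eq_proj hc hB hne hxC hx h1).trans (hB.proj_of_mem hc hx)
  simpa using mul_mem hkN hmem

end StabGenerated

/-! ### Stabilizers of vertices -/

/-- If `t` fixes `x` and moves the block `C` at `x` to the block `B`, then interchanging the two
branches by means of `t` is an automorphism. -/
theorem exists_swap (hc : X.Connected) (hB : X.IsBlockSet B) (hC : X.IsBlockSet C) (hBC : B ≠ C)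
    (hxB : x ∈ B) (hxC : x ∈ C) {t : X ≃g X} (htx : t • x = x) (htC : t • C = B) :
    ∃ s : X ≃g X, s • C = B ∧ s • x = x ∧
      ∀ v, X.proj B v = x → X.proj C v = x → s • v = v := by
  classical
  have hBx := hB.proj_of_mem hc hxB
  have hCx := hC.proj_of_mem hc hxC
  have htp : ∀ v, X.proj B (t • v) = x ↔ X.proj C v = x := by
    intro v
    have := hC.proj_smul hc t v
    rw [htC] at this
    rw [this]
    exact ⟨fun h => smul_left_cancel t (h.trans htx.symm), fun h => by rw [h, htx]⟩
  have htp' : ∀ v, X.proj C (t⁻¹ • v) = x ↔ X.proj B v = x := by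
    intro v
    rw [← htp, smul_inv_smul]
  have hCB' : ∀ v, X.proj C v ≠ x → X.proj B v = x := by
    intro v hv
    rw [hC.proj_eq_proj hc hB hBC.symm hxC hxB (by rwa [hCx]), hBx]
  have hedge : ∀ {E : Set V} {a b : V}, X.IsBlockSet E → X.Adj a b → X.proj E a ≠ x →
      X.proj E b = x → b = x := by
    intro E a b hE hab ha hb
    by_contra hne
    refine ha ?_
    rw [hE.proj_eq_of_adj hc hab, hb]
    exact fun h => hne ((hE.proj_of_mem hc h.2).symm.trans hb)
  let φ : V → V := fun v =>
    if X.proj C v ≠ x then t • v else if X.proj B v ≠ x then t⁻¹ • v else v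
  have φC : ∀ {v}, X.proj C v ≠ x → φ v = t • v := fun h => if_pos h
  have φB : ∀ {v}, X.proj B v ≠ x → φ v = t⁻¹ • v := fun {v} h => by
    have : X.proj C v = x := by
      by_contra h'
      exact h (hCB' v h')
    simp only [φ, this, ne_eq, not_true_eq_false, if_false, h, not_false_eq_true, if_true]
  have φid : ∀ {v}, X.proj B v = x → X.proj C v = x → φ v = v := fun h h' => by
    simp only [φ, h, h', ne_eq, not_true_eq_false, if_false]
  have hinvol : ∀ v, φ (φ v) = v := by
    intro v
    by_cases hv : X.proj C v = x
    · by_cases hv' : X.proj B v = x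
      · rw [φid hv' hv, φid hv' hv]
      · rw [φB hv', φC (fun h => hv' ((htp' v).1 h)), smul_inv_smul]
    · rw [φC hv, φB (fun h => hv ((htp v).1 h)), inv_smul_smul]
  have hadj : ∀ a b, X.Adj a b → X.Adj (φ a) (φ b) := by
    have key1 : ∀ a b, X.Adj a b → X.proj C a ≠ x → X.Adj (φ a) (φ b) := by
      intro a b hab ha
      have hb : φ b = t • b := by
        by_cases hb : X.proj C b = x
        · rw [hedge hC hab ha hb, φid hBx hCx, htx]
        · exact φC hb
      rw [φC ha, hb]
      exact (adj_smul_iff t).2 hab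
    have key2 : ∀ a b, X.Adj a b → X.proj B a ≠ x → X.Adj (φ a) (φ b) := by
      intro a b hab ha
      have hb : φ b = t⁻¹ • b := by
        by_cases hb : X.proj B b = x
        · rw [hedge hB hab ha hb, φid hBx hCx, eq_inv_smul_iff, htx]
        · exact φB hb
      rw [φB ha, hb]
      exact (adj_smul_iff t⁻¹).2 hab
    intro a b hab
    by_cases h1 : X.proj C a = x
    swap
    · exact key1 a b hab h1
    by_cases h2 : X.proj B a = x
    swap
    · exact key2 a b hab h2
    by_cases h3 : X.proj C b = x
    swap
    · exact (key1 b a hab.symm h3).symm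
    by_cases h4 : X.proj B b = x
    swap
    · exact (key2 b a hab.symm h4).symm
    rwa [φid h2 h1, φid h4 h3]
  refine ⟨autOfMaps φ φ hinvol hinvol hadj hadj, ?_, φid hBx hCx, fun v h1 h2 => φid h1 h2⟩
  rw [← htC]
  refine Set.image_congr fun v hv => ?_
  change φ v = t • v
  by_cases hvx : X.proj C v = x
  · rw [hC.proj_of_mem hc hv] at hvx
    rw [hvx, φid hBx hCx, htx]
  · exact φC hvx

/-- A swap of `g • B` and `B` fixes `D` pointwise, so it belongs to `flagSubgroup`; after it, `g`
preserves the flag `(x, B)`. -/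
theorem StabGenerated.mem_flagSubgroup_of_third (hX : X.StabGenerated) {g : X ≃g X}
    (hgx : g • x = x) (hB : X.IsBlockSet B) (hxB : x ∈ B) (hD : X.IsBlockSet D) (hxD : x ∈ D)
    (hDB : D ≠ B) (hDg : D ≠ g • B) : g ∈ X.flagSubgroup := by
  have hc := hX.connected
  by_cases hgB : g • B = B
  · exact hB.mem_flagSubgroup hxB hgB hgx
  have hxg : x ∈ g • B := Set.mem_smul_set.2 ⟨x, hxB, hgx⟩
  obtain ⟨s, hs, hsx, hsv⟩ := exists_swap hc hB (hB.smul g) (fun h => hgB h.symm) hxB hxg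
    (t := g⁻¹) (by rw [inv_smul_eq_iff, hgx]) (inv_smul_smul _ _)
  have hsD : ∀ v ∈ D, s • v = v := by
    intro v hv
    refine hsv v ?_ ?_
    · rw [hB.proj_const hc hD hDB.symm hv hxD, hB.proj_of_mem hc hxB]
    · rw [(hB.smul g).proj_const hc hD hDg.symm hv hxD, (hB.smul g).proj_of_mem hc hxg]
  have hs1 : s ∈ X.flagSubgroup := by
    refine hD.mem_flagSubgroup hxD ?_ hsx
    exact (Set.image_congr hsD).trans (Set.image_id D)
  have hs2 : s * g ∈ X.flagSubgroup := by
    refine hB.mem_flagSubgroup hxB ?_ ?_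
    · rw [mul_smul, hs]
    · rw [mul_smul, hgx, hsx]
  simpa using mul_mem (inv_mem hs1) hs2

/-- Every vertex lies in exactly two blocks and all blocks are isomorphic, in terms of vertex
sets. -/
def TwoIsoBlockSets (X : SimpleGraph V) : Prop :=
  (∀ x, {S | X.IsBlockSet S ∧ x ∈ S}.encard = 2) ∧
    ∀ B C, X.IsBlockSet B → X.IsBlockSet C → X.IsoBlocks B C

theorem encard_blocks_smul (g : X ≃g X) (x : V) :
    {S | X.IsBlockSet S ∧ g • x ∈ S}.encard = {S | X.IsBlockSet S ∧ x ∈ S}.encard := by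
  rw [← (MulAction.injective g).injOn.encard_image (s := {S | X.IsBlockSet S ∧ x ∈ S})]
  congr 1
  ext S
  constructor
  · rintro ⟨hS, hx⟩
    exact ⟨g⁻¹ • S, ⟨hS.smul _, by rwa [Set.mem_inv_smul_set_iff]⟩, smul_inv_smul _ _⟩
  · rintro ⟨S, ⟨hS, hx⟩, rfl⟩
    exact ⟨hS.smul g, Set.smul_mem_smul_set hx⟩

theorem StabGenerated.flagSubgroup_eq_top (hX : X.StabGenerated) (h : ¬ X.TwoIsoBlockSets) :
    X.flagSubgroup = ⊤ := by
  rw [Subgroup.eq_top_iff']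
  intro g
  obtain ⟨x⟩ := hX.connected.nonempty
  obtain ⟨k, hk, hkx⟩ := hX.exists_smul_eq (g • x) x
  suffices hkg : k * g ∈ X.flagSubgroup by simpa using mul_mem (inv_mem hk) hkg
  rw [← mul_smul] at hkx
  generalize k * g = a at hkx
  obtain ⟨B, hB, hxB⟩ := exists_isBlockSet_mem (X := X) x
  by_cases haB : a • B = B
  · exact hB.mem_flagSubgroup hxB haB hkx
  by_cases hD : ∃ D, X.IsBlockSet D ∧ x ∈ D ∧ D ≠ B ∧ D ≠ a • B
  · obtain ⟨D, hD, hxD, h1, h2⟩ := hD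
    exact hX.mem_flagSubgroup_of_third hkx hB hxB hD hxD h1 h2
  refine absurd ?_ h
  have hxa : x ∈ a • B := Set.mem_smul_set.2 ⟨x, hxB, hkx⟩
  have hset : {S | X.IsBlockSet S ∧ x ∈ S} = {B, a • B} := by
    ext S
    constructor
    · rintro ⟨hS, hxS⟩
      by_contra hn
      exact hD ⟨S, hS, hxS, fun h => hn (Or.inl h), fun h => hn (Or.inr h)⟩
    · rintro (rfl | rfl)
      · exact ⟨hB, hxB⟩
      · exact ⟨hB.smul a, hxa⟩
  constructor
  · intro y
    obtain ⟨m, rfl⟩ := hX.isTransitive.exists_smul_eq x y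
    rw [encard_blocks_smul, hset, Set.encard_pair (Ne.symm haB)]
  · have key : ∀ E, X.IsBlockSet E → X.IsoBlocks E B := by
      intro E hE
      obtain ⟨y, hy⟩ := hE.1.1
      obtain ⟨m, rfl⟩ := hX.isTransitive.exists_smul_eq y x
      have hm : m • E ∈ ({B, a • B} : Set (Set V)) :=
        hset ▸ ⟨hE.smul m, Set.smul_mem_smul_set hy⟩
      have h1 := hE.isoBlocks_smul m
      rcases hm with hm | hm
      · rwa [hm] at h1
      · have hm : m • E = a • B := hm
        rw [hm] at h1
        exact h1.trans (hB.isoBlocks_smul a).symm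
    exact fun E F hE hF => (key E hE).trans (key F hF).symm

/-- `flagSubgroup_le` asks only for invariance under `flagSubgroup`, so it applies to a normal
subgroup of `flagSubgroup` that need not be normal in the full group. -/
theorem StabGenerated.isSimpleGroup_flagSubgroup (hX : X.StabGenerated) :
    IsSimpleGroup X.flagSubgroup := by
  have : Nontrivial X.flagSubgroup := by
    obtain ⟨x⟩ := hX.connected.nonempty
    obtain ⟨B, hB, hxB⟩ := exists_isBlockSet_mem (X := X) x
    obtain ⟨y, hy, hyx, -⟩ := hX.exists_third hB hxB x
    obtain ⟨g, hg, -, hgx⟩ := hX.exists_smul_eq_of_mem hB hxB hy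
    refine ⟨⟨g, hg⟩, 1, fun h => hyx ?_⟩
    have h1 : g = 1 := congrArg Subtype.val h
    rw [← hgx, h1, one_smul]
  refine ⟨fun K hK => ?_⟩
  rw [or_iff_not_imp_left]
  intro hKne
  have h1 := hX.flagSubgroup_le (N := K.map X.flagSubgroup.subtype)
    (by
      rintro k hk _ ⟨n, hn, rfl⟩
      exact ⟨_, hK.conj_mem n hn ⟨k, hk⟩, rfl⟩)
    (by
      rwa [Ne, Subgroup.map_eq_bot_iff_of_injective _ (Subgroup.subtype_injective _)])
  rw [Subgroup.eq_top_iff']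
  intro a
  obtain ⟨b, hb, hba⟩ := h1 a.2
  rwa [← Subtype.ext hba]

/-! ### Colouring the blocks -/

/-- Every vertex lies in a block that is a root block or in which it is not the vertex closest to
the root block. -/
theorem IsBlockSet.exists_parent (hc : X.Connected) (hR : X.IsBlockSet R) (u : V) :
    ∃ E, X.IsBlockSet E ∧ u ∈ E ∧ (E = R ∨ ∀ r ∈ R, X.proj E r ≠ u) := by
  by_contra! hcon
  obtain ⟨r, hr⟩ := hR.1.1
  have huR : u ∉ R := fun h => (hcon R hR h).1 rfl
  have h0 : ∀ E, X.IsBlockSet E → u ∈ E → X.proj E r = u := by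
    intro E hE huE
    obtain ⟨hER, r', hr', h⟩ := hcon E hE huE
    rw [hE.proj_const hc hR hER hr hr', h]
  -- Without a parent block, every block at `u` sees `r` in the direction of `u`. This property
  -- passes along edges and can never reach `u`, against connectedness.
  have := hc.pred (P := fun v => v ≠ u ∧ ∀ E, X.IsBlockSet E → u ∈ E → X.proj E v = u) (u := r)
    (by
      rintro a b hab ⟨hau, ha⟩
      constructor
      · rintro rfl
        obtain ⟨F, hF, haF, hbF⟩ := exists_isBlockSet_of_adj hab
        exact hau ((hF.proj_of_mem hc haF).symm.trans (ha F hF hbF))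
      · intro E hE huE
        rw [← hE.proj_eq_of_adj hc hab, ha E hE huE]
        exact fun h => hau ((hE.proj_of_mem hc h.1).symm.trans (ha E hE huE)))
    ⟨fun h => huR (h ▸ hr), h0⟩ u
  exact this.1 rfl

open Classical in
/-- The distance of the block `C` from the block `R` in the tree of blocks, where `r ∈ R`. -/
noncomputable def blockDepth (X : SimpleGraph V) (R : Set V) (r : V) (C : Set V) : ℕ :=
  {E | X.IsBlockSet E ∧ E ≠ R ∧ X.proj E r ≠ X.proj E (X.proj C r)}.ncard + if C = R then 0 else 1

/-- `D` is attached at `u`. Going from the parent `C` to `D` adds exactly `C` to the separating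
blocks, unless `C = R`, which is never counted; then the final summand rises from 0 to 1 instead. -/
theorem blockDepth_eq_succ (hc : X.Connected) (hR : X.IsBlockSet R) (hr : r ∈ R)
    (hC : X.IsBlockSet C) (hD : X.IsBlockSet D) (hCD : D ≠ C) (huC : u ∈ C) (huD : u ∈ D)
    (h : C = R ∨ ∀ r ∈ R, X.proj C r ≠ u) :
    X.blockDepth R r D = X.blockDepth R r C + 1 := by
  obtain ⟨hDR, hDu⟩ := hR.proj_eq_of_parent hc hD hC hCD huD huC h
  unfold blockDepth
  rw [hDu r hr, if_neg hDR]
  congr 1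
  by_cases hCR : C = R
  · subst hCR
    rw [if_pos rfl, hC.proj_of_mem hc hr, add_zero]
    congr 1
    ext E
    refine and_congr_right fun hE => and_congr_right fun hER => ?_
    rw [hE.proj_const hc hC hER hr huC]
  · have hCu := h.resolve_left hCR r hr
    have hq := hC.proj_mem hc r
    have hfin : {E | X.IsBlockSet E ∧ E ≠ R ∧ X.proj E r ≠ X.proj E (X.proj C r)}.Finite :=
      (hc.finite_setOf_proj_ne r (X.proj C r)).subset fun E hE => ⟨hE.1, hE.2.2⟩
    rw [if_neg hCR, ← Set.ncard_insert_of_notMem (a := C) ?_ hfin]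
    · congr 1
      ext E
      by_cases hEC : E = C
      · subst hEC
        simp only [Set.mem_insert_iff, true_or, iff_true]
        exact ⟨hC, hCR, by rwa [hC.proj_of_mem hc huC]⟩
      · rw [Set.mem_insert_iff, or_iff_right hEC]
        refine and_congr_right fun hE => and_congr_right fun hER => ?_
        rw [hE.proj_const hc hC hEC huC hq]
    · rintro ⟨-, -, h3⟩
      exact h3 (hC.proj_of_mem hc hq).symm

theorem even_blockDepth_iff (hc : X.Connected) (hR : X.IsBlockSet R) (hr : r ∈ R)
    (h2 : ∀ u B C E, X.IsBlockSet B → X.IsBlockSet C → X.IsBlockSet E → u ∈ B → u ∈ C → u ∈ E →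
      B ≠ C → E = B ∨ E = C)
    (hC : X.IsBlockSet C) (hD : X.IsBlockSet D) (hCD : C ≠ D) (huC : u ∈ C) (huD : u ∈ D) :
    Even (X.blockDepth R r C) ↔ ¬ Even (X.blockDepth R r D) := by
  obtain ⟨E, hE, huE, hpar⟩ := hR.exists_parent hc u
  rcases h2 u C D E hC hD hE huC huD huE hCD with rfl | rfl
  · rw [blockDepth_eq_succ hc hR hr hE hD hCD.symm huE huD hpar, Nat.even_add_one, not_not]
  · rw [blockDepth_eq_succ hc hR hr hE hC hCD huE huC hpar, Nat.even_add_one]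

theorem exists_eq_of_encard_eq_two {α : Type*} {s : Set α} (hs : s.encard = 2) {a b e : α}
    (ha : a ∈ s) (hb : b ∈ s) (he : e ∈ s) (hab : a ≠ b) : e = a ∨ e = b := by
  obtain ⟨p, q, hpq, rfl⟩ := Set.encard_eq_two.1 hs
  rcases ha with rfl | rfl <;> rcases hb with rfl | rfl <;> rcases he with rfl | rfl <;> simp_all

/-- A two-colouring of the blocks in which blocks that meet have different colours is respected
by an automorphism as soon as one block keeps its colour. -/
theorem Connected.color_smul_iff (hc : X.Connected) {κ : Set V → Prop}
    (hκ : ∀ C D u, X.IsBlockSet C → X.IsBlockSet D → C ≠ D → u ∈ C → u ∈ D → (κ C ↔ ¬ κ D))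
    (hB : X.IsBlockSet B) {g : X ≃g X} (hg : κ (g • B) ↔ κ B) (hC : X.IsBlockSet C) :
    κ (g • C) ↔ κ C := by
  have hlocal : ∀ C D u, X.IsBlockSet C → X.IsBlockSet D → u ∈ C → u ∈ D →
      (κ (g • C) ↔ κ C) → (κ (g • D) ↔ κ D) := by
    intro C D u hC hD huC huD h
    by_cases hCD : D = C
    · rwa [hCD]
    · have hne : g • D ≠ g • C := fun h => hCD (smul_left_cancel g h)
      rw [hκ D C u hD hC hCD huD huC, hκ (g • D) (g • C) (g • u) (hD.smul g) (hC.smul g) hne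
        (Set.smul_mem_smul_set huD) (Set.smul_mem_smul_set huC), h]
  obtain ⟨x, hx⟩ := hB.1.1
  obtain ⟨y, hy⟩ := hC.1.1
  refine hc.pred (P := fun v => ∀ C, X.IsBlockSet C → v ∈ C → (κ (g • C) ↔ κ C)) ?_
    (fun D hD hxD => hlocal B D x hB hD hx hxD hg) y C hC hy
  intro a b hab ha D hD hbD
  obtain ⟨F, hF, haF, hbF⟩ := exists_isBlockSet_of_adj hab
  exact hlocal F D b hF hD hbF hbD (ha F hF haF)

theorem StabGenerated.index_flagSubgroup (hX : X.StabGenerated) (h : X.TwoIsoBlockSets) :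
    X.flagSubgroup.index = 2 := by
  have hc := hX.connected
  obtain ⟨x⟩ := hc.nonempty
  obtain ⟨B, hB, hxB⟩ := exists_isBlockSet_mem (X := X) x
  obtain ⟨C, hC, hxC, hCB⟩ := hX.hasConnectivityOne.exists_ne hX.isTransitive B x
  have h2 : ∀ u B C E, X.IsBlockSet B → X.IsBlockSet C → X.IsBlockSet E → u ∈ B → u ∈ C → u ∈ E →
      B ≠ C → E = B ∨ E = C := fun u B C E hB hC hE huB huC huE hBC =>
    exists_eq_of_encard_eq_two (h.1 u) ⟨hB, huB⟩ ⟨hC, huC⟩ ⟨hE, huE⟩ hBC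
  -- Parity of depth is a proper colouring: of the two blocks at a vertex, one is the parent and the
  -- other is one step deeper.
  obtain ⟨κ, hκ⟩ : ∃ κ : Set V → Prop, ∀ C D u, X.IsBlockSet C → X.IsBlockSet D → C ≠ D →
      u ∈ C → u ∈ D → (κ C ↔ ¬ κ D) :=
    ⟨fun C => Even (X.blockDepth B x C), fun C D u hC hD hCD huC huD =>
      even_blockDepth_iff hc hB hxB h2 hC hD hCD huC huD⟩
  have hpres : ∀ g ∈ X.flagSubgroup, ∀ D, X.IsBlockSet D → (κ (g • D) ↔ κ D) := by
    intro g hg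
    induction hg using Subgroup.closure_induction with
    | mem k hk =>
      obtain ⟨E, y, hE, -, hkE, -⟩ := hk
      exact fun D hD => hc.color_smul_iff hκ hE (by rw [hkE]) hD
    | one => exact fun D _ => by rw [one_smul]
    | mul a b _ _ ha hb => exact fun D hD => by rw [mul_smul, ha _ (hD.smul b), hb D hD]
    | inv a _ ha =>
      intro D hD
      rw [← ha _ (hD.smul a⁻¹), smul_inv_smul]
  have hmem : ∀ g : X ≃g X, g ∈ X.flagSubgroup ↔ (κ (g • B) ↔ κ B) := by
    refine fun g => ⟨fun hg => hpres g hg B hB, fun hg => ?_⟩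
    obtain ⟨k, hk, hkx⟩ := hX.exists_smul_eq (g • x) x
    rw [← mul_smul] at hkx
    have hxk : x ∈ (k * g) • B := Set.mem_smul_set.2 ⟨x, hxB, hkx⟩
    rcases h2 x B C _ hB hC (hB.smul (k * g)) hxB hxC hxk hCB.symm with h3 | h3
    · simpa using mul_mem (inv_mem hk) (hB.mem_flagSubgroup hxB h3 hkx)
    -- Here `k * g` takes `B` to `C`, of the opposite colour, although `k` preserves colours and `g`
    -- keeps that of `B`.
    · have h4 := hpres k hk (g • B) (hB.smul g)
      rw [← mul_smul, h3, hg, hκ C B x hC hB hCB hxC hxB] at h4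
      exact absurd h4 (by tauto)
  -- An automorphism taking `B` to `C` reverses the colours and represents the other coset.
  obtain ⟨β⟩ := (h.2 B C hB hC).2.2
  obtain ⟨s, hs, -⟩ := exists_aut_extending hc hX.isTransitive hX.block_isTransitive hB hC β
  rw [Subgroup.index_eq_two_iff]
  refine ⟨s, fun b => ?_⟩
  have hne : b • C ≠ b • B := fun h => hCB (smul_left_cancel b h)
  rw [hmem, hmem, mul_smul, hs, hκ (b • C) (b • B) (b • x) (hC.smul b) (hB.smul b) hne
    (Set.smul_mem_smul_set hxC) (Set.smul_mem_smul_set hxB)]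
  rw [xor_iff_iff_not]
  tauto

/-! ### Return to blocks as subgraphs, and the theorem -/

theorem hasTwoIsomorphicBlocks_iff : X.HasTwoIsomorphicBlocks ↔ X.TwoIsoBlockSets := by
  unfold HasTwoIsomorphicBlocks TwoIsoBlockSets
  simp only [numBlocksAt_eq]
  refine and_congr_right fun _ => ⟨fun h B C hB hC => ?_, fun h B C hB hC => ?_⟩
  · have := h _ _ hB.isBlock hC.isBlock
    rw [hB.isBlock.coe_eq, hC.isBlock.coe_eq] at this
    exact ⟨hB, hC, this⟩
  · rw [hB.coe_eq, hC.coe_eq]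
    exact (h _ _ hB.isBlockSet hC.isBlockSet).2.2

theorem StabGenerated.of_blocks (htrans : X.IsTransitive) (hconn : X.HasConnectivityOne)
    (h : ∀ B : X.Subgraph, X.IsBlock B → B.coe.IsTransitive ∧ B.coe.AutGeneratedByStabilizers) :
    X.StabGenerated := by
  have key : ∀ S, X.IsBlockSet S →
      (X.induce S).IsTransitive ∧ (X.induce S).AutGeneratedByStabilizers := by
    intro S hS
    have := h _ hS.isBlock
    rwa [hS.isBlock.coe_eq] at this
  exact ⟨htrans, hconn, fun S hS => (key S hS).1, fun S hS => (key S hS).2⟩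

end SimpleGraph

theorem theorem13 {V : Type*} (X : SimpleGraph V)
    (htrans : X.IsTransitive) (hconn : X.HasConnectivityOne) :
    ((∃ B : X.Subgraph, X.IsBlock B ∧ ¬ B.coe.IsTransitive) → ¬ IsSimpleGroup (X ≃g X)) ∧
    ((∀ B : X.Subgraph, X.IsBlock B → B.coe.IsTransitive ∧ B.coe.AutGeneratedByStabilizers) →
      (¬ X.HasTwoIsomorphicBlocks → IsSimpleGroup (X ≃g X)) ∧
      (X.HasTwoIsomorphicBlocks →
        ∃ N : Subgroup (X ≃g X), N.Normal ∧ IsSimpleGroup N ∧ N.index = 2)) := by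
  refine ⟨?_, fun h => ?_⟩
  · rintro ⟨B, hB, hn⟩
    rw [hB.coe_eq] at hn
    exact SimpleGraph.not_isSimpleGroup_of_not_isTransitive hconn.1 htrans hB.isBlockSet hn
  · have hX := SimpleGraph.StabGenerated.of_blocks htrans hconn h
    have hsimple := hX.isSimpleGroup_flagSubgroup
    rw [SimpleGraph.hasTwoIsomorphicBlocks_iff]
    refine ⟨fun h2 => ?_, fun h2 => ?_⟩
    · rw [hX.flagSubgroup_eq_top h2] at hsimple
      exact Subgroup.topEquiv.isSimpleGroup_congr.1 hsimple
    · exact ⟨X.flagSubgroup, SimpleGraph.flagSubgroup_normal, hsimple, hX.index_flagSubgroup h2⟩
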